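/- \textbf{Definitions.} A \emph{topological category} is a category internal to topological spaces: spaces of objects $C_0$ and of morphisms $C_1$ with continuous source, target, identity-assigning and composition maps. A \emph{topological 2-group} is a coherent 2-group in the 2-category of topological categories, continuous functors and continuous natural transformations: a topological category $C$ with a continuous multiplication functor $\otimes$, a unit object $1$, a continuous inverse functor $x\mapsto\bar x$, and continuous natural isomorphisms $a_{x,y,z}\colon (x\otimes y)\otimes z\to x\otimes(y\otimes z)$, $\ell_x\colon 1\otimes x\to x$, $r_x\colon x\otimes 1\to x$, $i_x\colon 1\to x\otimes\bar x$, $e_x\colon \bar x\otimes x\to 1$ satisfying the pentagon, triangle and two zig-zag identities. It is \emph{special} if the source and target maps $C_1\to C_0$ coincide and $\ell,r,i,e$ are identity natural transformations, and a special one is \emph{strict} if $a$ is also an identity natural transformation. For a special topological 2-group $C$, the objects form a topological group $G$ under $\otimes$, the endomorphisms of $1$ form a topological abelian group $H$ under composition, and $G$ acts continuously on $H$ by $\alpha(g)h=(1_g\otimes h)\otimes 1_{\bar g}$. The associator gives a continuous map $a\colon G^3\to H$, $a(g_1,g_2,g_3)=a_{g_1,g_2,g_3}\otimes 1_{\overline{g_1\otimes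 g_2\otimes g_3}}$, which is a 3-cocycle in the complex of continuous inhomogeneous cochains $G^n\to H$ with the usual group cohomology differential; let $[a]\in H^3_{\rm cont}(G,H)$ be its class in the cohomology of this complex. A \emph{homomorphism} of topological 2-groups is a continuous functor $F$ with continuous natural isomorphisms $F_2\colon F(x)\otimes F(y)\to F(x\otimes y)$ and an isomorphism $F_0\colon 1'\to F(1)$ making it a weak monoidal functor; it is \emph{special} if $F_0$ is an identity morphism. A \emph{2-homomorphism} is a continuous monoidal natural transformation. Special topological 2-groups $C$, $D$ are \emph{equivalent} if there are special homomorphisms $F\colon C\to D$ and $F'\colon D\to C$ whose two composites are isomorphic, via invertible 2-homomorphisms, to the identity homomorphisms. \textbf{Theorem.} Let $G$ be a connected compact Lie group and $H$ a connected abelian Lie group. Suppose $C$ is a special topological 2-group whose topological group of objects is (isomorphic to) $G$ and whose topological group of endomorphisms of the unit object is (isomorphic to) $H$. Then the class $[a]\in H^3_{\rm cont}(G,H)$ of the associator of $C$ is $0$, and $C$ is equivalent, in the above sense, to a strict special topological 2-group. -/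

import Mathlib

open CategoryTheory MonoidalCategory

universe u

/-! ### Topological categories -/

/-- A topological category, i.e. an internal category in the category of topological spaces:
a space of objects, a space of morphisms, and continuous source, target, identity-assigning and
composition maps.  Composition is defined on the pullback of the target and source maps and is
written in diagrammatic order: `comp ⟨(f, g), _⟩` is "first `f`, then `g`". -/
structure TopologicalCategory where
  Obj : Type u
  Mor : Type u
  [topObj : TopologicalSpace Obj]
  [topMor : TopologicalSpace Mor]
  src : Mor → Obj
  tgt : Mor → Obj
  ident : Obj → Mor
  comp : {p : Mor × Mor // tgt p.1 = src p.2} → Mor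
  continuous_src : Continuous src
  continuous_tgt : Continuous tgt
  continuous_ident : Continuous ident
  continuous_comp : Continuous comp
  src_ident : ∀ x, src (ident x) = x
  tgt_ident : ∀ x, tgt (ident x) = x
  src_comp : ∀ p, src (comp p) = src p.1.1
  tgt_comp : ∀ p, tgt (comp p) = tgt p.1.2
  assoc : ∀ (f g h : Mor) (hfg : tgt f = src g) (hgh : tgt g = src h),
    comp ⟨(comp ⟨(f, g), hfg⟩, h), (tgt_comp ⟨(f, g), hfg⟩).trans hgh⟩ =
      comp ⟨(f, comp ⟨(g, h), hgh⟩), hfg.trans (src_comp ⟨(g, h), hgh⟩).symm⟩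
  ident_comp : ∀ f, comp ⟨(ident (src f), f), tgt_ident _⟩ = f
  comp_ident : ∀ f, comp ⟨(f, ident (tgt f)), (src_ident _).symm⟩ = f

attribute [instance] TopologicalCategory.topObj TopologicalCategory.topMor

namespace TopologicalCategory

/-- The morphisms from `x` to `y` in a topological category. -/
@[ext]
structure Hom (X : TopologicalCategory.{u}) (x y : X.Obj) where
  mor : X.Mor
  src_eq : X.src mor = x
  tgt_eq : X.tgt mor = y

/-- The underlying category of a topological category. -/
instance underlying (X : TopologicalCategory.{u}) : Category.{u} X.Obj where
  Hom x y := X.Hom x y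
  id x := ⟨X.ident x, X.src_ident x, X.tgt_ident x⟩
  comp f g := ⟨X.comp ⟨(f.mor, g.mor), f.tgt_eq.trans g.src_eq.symm⟩,
    (X.src_comp _).trans f.src_eq, (X.tgt_comp _).trans g.tgt_eq⟩
  id_comp := by
    rintro x y ⟨f, rfl, rfl⟩
    exact Hom.ext (X.ident_comp f)
  comp_id := by
    rintro x y ⟨f, rfl, rfl⟩
    exact Hom.ext (X.comp_ident f)
  assoc := by
    rintro w x y z ⟨f, rfl, rfl⟩ ⟨g, hg, rfl⟩ ⟨h, hh, rfl⟩
    exact Hom.ext (X.assoc f g h hg.symm hh.symm)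

variable {X Y : TopologicalCategory.{u}}

/-- The element of the space of morphisms given by a morphism of the underlying category. -/
def mor {x y : X.Obj} (f : x ⟶ y) : X.Mor := Hom.mor f

/-- An element of the space of morphisms, as a morphism of the underlying category. -/
def hom (f : X.Mor) : X.src f ⟶ X.tgt f := Hom.mk f rfl rfl

/-- A functor between the underlying categories is a functor of topological categories (an
internal functor) when it is continuous on objects and on morphisms. -/
structure IsContinuousFunctor (F : X.Obj ⥤ Y.Obj) : Prop where
  continuous_obj : Continuous F.obj
  continuous_map : Continuous fun f : X.Mor => mor (F.map (hom f))

end TopologicalCategory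

open TopologicalCategory

/-! ### Coherent 2-groups in topological categories -/

/-- A topological 2-group: a coherent 2-group in the 2-category of topological categories,
continuous functors and continuous natural transformations.  The multiplication functor, the unit
object, the associator `α_` and the left and right unit laws `λ_`, `ρ_`, with the pentagon and
triangle identities, form a monoidal structure on the underlying category; `inv` is the inverse
functor, and `unit`, `counit` are natural isomorphisms satisfying the zig-zag identities. All
structure maps (including those of the inverse 2-morphisms) are continuous. -/
structure TopologicalTwoGroup where
  cat : TopologicalCategory.{u}
  [monoidal : MonoidalCategory cat.Obj]
  inv : cat.Obj ⥤ cat.Obj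
  unit : ∀ x : cat.Obj, 𝟙_ cat.Obj ≅ x ⊗ inv.obj x
  counit : ∀ x : cat.Obj, inv.obj x ⊗ x ≅ 𝟙_ cat.Obj
  unit_naturality : ∀ {x y : cat.Obj} (f : x ⟶ y),
    (unit x).hom ≫ (f ⊗ₘ inv.map f) = (unit y).hom
  counit_naturality : ∀ {x y : cat.Obj} (f : x ⟶ y),
    (inv.map f ⊗ₘ f) ≫ (counit y).hom = (counit x).hom
  zigzag_first : ∀ x : cat.Obj,
    (unit x).hom ▷ x ≫ (α_ x (inv.obj x) x).hom ≫ x ◁ (counit x).hom =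
      (λ_ x).hom ≫ (ρ_ x).inv
  zigzag_second : ∀ x : cat.Obj,
    inv.obj x ◁ (unit x).hom ≫ (α_ (inv.obj x) x (inv.obj x)).inv ≫ (counit x).hom ▷ inv.obj x =
      (ρ_ (inv.obj x)).hom ≫ (λ_ (inv.obj x)).inv
  continuous_tensorObj : Continuous fun p : cat.Obj × cat.Obj => p.1 ⊗ p.2
  continuous_tensorHom : Continuous fun p : cat.Mor × cat.Mor => mor (hom p.1 ⊗ₘ hom p.2)
  continuous_inv : IsContinuousFunctor inv
  continuous_associator_hom : Continuous fun p : cat.Obj × cat.Obj × cat.Obj =>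
    mor (α_ p.1 p.2.1 p.2.2).hom
  continuous_associator_inv : Continuous fun p : cat.Obj × cat.Obj × cat.Obj =>
    mor (α_ p.1 p.2.1 p.2.2).inv
  continuous_leftUnitor_hom : Continuous fun x : cat.Obj => mor (λ_ x).hom
  continuous_leftUnitor_inv : Continuous fun x : cat.Obj => mor (λ_ x).inv
  continuous_rightUnitor_hom : Continuous fun x : cat.Obj => mor (ρ_ x).hom
  continuous_rightUnitor_inv : Continuous fun x : cat.Obj => mor (ρ_ x).inv
  continuous_unit_hom : Continuous fun x : cat.Obj => mor (unit x).hom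
  continuous_unit_inv : Continuous fun x : cat.Obj => mor (unit x).inv
  continuous_counit_hom : Continuous fun x : cat.Obj => mor (counit x).hom
  continuous_counit_inv : Continuous fun x : cat.Obj => mor (counit x).inv

attribute [instance] TopologicalTwoGroup.monoidal

/-- A homomorphism of topological 2-groups: a continuous functor which is weak monoidal through
continuous natural isomorphisms `ε : 1' ⟶ F(1)` and `μ : F(x) ⊗ F(y) ⟶ F(x ⊗ y)` (whose inverses
are `η` and `δ`). -/
structure TopologicalTwoGroup.Hom (C D : TopologicalTwoGroup.{u}) where
  functor : C.cat.Obj ⥤ D.cat.Obj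
  [monoidal : functor.Monoidal]
  continuous_functor : IsContinuousFunctor functor
  continuous_μ : Continuous fun p : C.cat.Obj × C.cat.Obj =>
    mor (Functor.LaxMonoidal.μ functor p.1 p.2)
  continuous_δ : Continuous fun p : C.cat.Obj × C.cat.Obj =>
    mor (Functor.OplaxMonoidal.δ functor p.1 p.2)

attribute [instance] TopologicalTwoGroup.Hom.monoidal

/-- A 2-homomorphism between homomorphisms of topological 2-groups: a continuous monoidal natural
transformation. -/
structure TopologicalTwoGroup.TwoHom {C D : TopologicalTwoGroup.{u}} (F G : C.Hom D) where
  nat : F.functor ⟶ G.functor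
  isMonoidal : NatTrans.IsMonoidal nat
  continuous_app : Continuous fun x : C.cat.Obj => mor (nat.app x)

/-- An invertible 2-homomorphism. -/
structure TopologicalTwoGroup.TwoIso {C D : TopologicalTwoGroup.{u}} (F G : C.Hom D) where
  hom : TwoHom F G
  inv : TwoHom G F
  hom_inv_id : hom.nat ≫ inv.nat = 𝟙 F.functor
  inv_hom_id : inv.nat ≫ hom.nat = 𝟙 G.functor

/-! ### Special topological 2-groups -/

/-- A special topological 2-group is a skeletal one (source and target of every morphism agree)
in which the left and right unit laws, the unit and the counit are identity natural
transformations. -/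
structure SpecialTopologicalTwoGroup extends TopologicalTwoGroup.{u} where
  skeletal : cat.src = cat.tgt
  leftUnitor_eq : ∀ x : cat.Obj, mor (λ_ x).hom = cat.ident x
  rightUnitor_eq : ∀ x : cat.Obj, mor (ρ_ x).hom = cat.ident x
  unit_eq : ∀ x : cat.Obj, mor (unit x).hom = cat.ident (𝟙_ cat.Obj)
  counit_eq : ∀ x : cat.Obj, mor (counit x).hom = cat.ident (𝟙_ cat.Obj)

/-! ### Helper facts about morphisms -/

namespace TopologicalCategory

variable {X Y : TopologicalCategory.{u}}

@[simp] lemma mor_hom (f : X.Mor) : mor (hom f) = f := rfl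

lemma mor_injective {x y : X.Obj} {f g : x ⟶ y} (h : mor f = mor g) : f = g := Hom.ext h

lemma src_mor {x y : X.Obj} (f : x ⟶ y) : X.src (mor f) = x := Hom.src_eq f

lemma tgt_mor {x y : X.Obj} (f : x ⟶ y) : X.tgt (mor f) = y := Hom.tgt_eq f

@[simp] lemma mor_id (x : X.Obj) : mor (𝟙 x) = X.ident x := rfl

lemma mor_comp {x y z : X.Obj} (f : x ⟶ y) (g : y ⟶ z) :
    mor (f ≫ g) = X.comp ⟨(mor f, mor g), (tgt_mor f).trans (src_mor g).symm⟩ := rfl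

lemma mor_map {x y : X.Obj} (F : X.Obj ⥤ Y.Obj) (f : x ⟶ y) :
    mor (F.map (hom (mor f))) = mor (F.map f) := by
  obtain ⟨f, rfl, rfl⟩ := f
  rfl

lemma mor_tensor [MonoidalCategory X.Obj] {x y x' y' : X.Obj} (f : x ⟶ y) (g : x' ⟶ y') :
    mor (hom (mor f) ⊗ₘ hom (mor g)) = mor (f ⊗ₘ g) := by
  obtain ⟨f, rfl, rfl⟩ := f
  obtain ⟨g, rfl, rfl⟩ := g
  rfl

lemma continuous_mor_comp {T : Type*} [TopologicalSpace T] {x y z : T → X.Obj}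
    {f : ∀ t, x t ⟶ y t} {g : ∀ t, y t ⟶ z t} (hf : Continuous fun t => mor (f t))
    (hg : Continuous fun t => mor (g t)) : Continuous fun t => mor (f t ≫ g t) :=
  X.continuous_comp.comp ((hf.prodMk hg).subtype_mk _)

lemma IsContinuousFunctor.continuous_mor_map {T : Type*} [TopologicalSpace T] {x y : T → X.Obj}
    {F : X.Obj ⥤ Y.Obj} (hF : IsContinuousFunctor F) {f : ∀ t, x t ⟶ y t}
    (hf : Continuous fun t => mor (f t)) : Continuous fun t => mor (F.map (f t)) := by
  simp only [← mor_map F (f _)]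
  exact hF.continuous_map.comp hf

lemma IsContinuousFunctor.id : IsContinuousFunctor (𝟭 X.Obj) where
  continuous_obj := continuous_id
  continuous_map := continuous_id

lemma IsContinuousFunctor.comp {Z : TopologicalCategory.{u}} {F : X.Obj ⥤ Y.Obj}
    {G : Y.Obj ⥤ Z.Obj} (hF : IsContinuousFunctor F) (hG : IsContinuousFunctor G) :
    IsContinuousFunctor (F ⋙ G) where
  continuous_obj := hG.continuous_obj.comp hF.continuous_obj
  continuous_map := hG.continuous_mor_map hF.continuous_map

end TopologicalCategory

/-! ### The 2-category of special topological 2-groups -/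

namespace TopologicalTwoGroup

variable {C D E : TopologicalTwoGroup.{u}}

/-- The identity homomorphism. -/
def Hom.id (C : TopologicalTwoGroup.{u}) : C.Hom C where
  functor := 𝟭 C.cat.Obj
  continuous_functor := .id
  continuous_μ := C.cat.continuous_ident.comp C.continuous_tensorObj
  continuous_δ := C.cat.continuous_ident.comp C.continuous_tensorObj

/-- Composition of homomorphisms ("first `F`, then `G`"). -/
def Hom.comp (F : C.Hom D) (G : D.Hom E) : C.Hom E where
  functor := F.functor ⋙ G.functor
  continuous_functor := F.continuous_functor.comp G.continuous_functor
  continuous_μ := by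
    simp only [Functor.LaxMonoidal.comp_μ]
    exact continuous_mor_comp
      (G.continuous_μ.comp (F.continuous_functor.continuous_obj.prodMap
        F.continuous_functor.continuous_obj))
      (G.continuous_functor.continuous_mor_map F.continuous_μ)
  continuous_δ := by
    simp only [Functor.OplaxMonoidal.comp_δ]
    exact continuous_mor_comp
      (G.continuous_functor.continuous_mor_map F.continuous_δ)
      (G.continuous_δ.comp (F.continuous_functor.continuous_obj.prodMap
        F.continuous_functor.continuous_obj))

/-- A homomorphism `F` is special when the isomorphism `1' ⟶ F(1)` is an identity morphism. -/
def Hom.IsSpecial (F : C.Hom D) : Prop :=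
  mor (Functor.LaxMonoidal.ε F.functor) = D.cat.ident (𝟙_ D.cat.Obj)

end TopologicalTwoGroup

namespace SpecialTopologicalTwoGroup

/-- Equivalence of objects in the 2-category of special topological 2-groups, special
homomorphisms and arbitrary 2-homomorphisms: there are special homomorphisms in both directions
whose two composites are isomorphic, through invertible 2-homomorphisms, to the identities. -/
def Equivalent (C D : SpecialTopologicalTwoGroup.{u}) : Prop :=
  ∃ (F : C.toTopologicalTwoGroup.Hom D.toTopologicalTwoGroup)
    (G : D.toTopologicalTwoGroup.Hom C.toTopologicalTwoGroup),
    F.IsSpecial ∧ G.IsSpecial ∧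
    Nonempty (TopologicalTwoGroup.TwoIso (F.comp G) (.id C.toTopologicalTwoGroup)) ∧
    Nonempty (TopologicalTwoGroup.TwoIso (G.comp F) (.id D.toTopologicalTwoGroup))

/-- A special topological 2-group is strict when its associator is also an identity natural
transformation (the other structural 2-morphisms being identities already). -/
def IsStrict (C : SpecialTopologicalTwoGroup.{u}) : Prop :=
  ∀ x y z : C.cat.Obj, mor (α_ x y z).hom = C.cat.ident ((x ⊗ y) ⊗ z)

variable (C : SpecialTopologicalTwoGroup.{u})

/-! ### The topological groups of objects and of endomorphisms of the unit object -/

variable {C} in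
lemma eq_of_hom {x y : C.cat.Obj} (f : x ⟶ y) : x = y := by
  rw [← src_mor f, C.skeletal, tgt_mor f]

variable {C} in
lemma tgt_eq_src (f : C.cat.Mor) : C.cat.tgt f = C.cat.src f := (congrFun C.skeletal f).symm

/-- The group of objects: multiplication is the tensor product, inversion is `inv`. -/
instance objGroup : Group C.cat.Obj where
  mul x y := x ⊗ y
  one := 𝟙_ C.cat.Obj
  inv x := C.inv.obj x
  mul_assoc x y z := eq_of_hom (α_ x y z).hom
  one_mul x := eq_of_hom (λ_ x).hom
  mul_one x := eq_of_hom (ρ_ x).hom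
  inv_mul_cancel x := eq_of_hom (C.counit x).hom

instance : IsTopologicalGroup C.cat.Obj where
  continuous_mul := C.continuous_tensorObj
  continuous_inv := C.continuous_inv.continuous_obj

variable {C} in
/-- The tensor product, on the space of morphisms. -/
def tensorMor (f g : C.cat.Mor) : C.cat.Mor := mor (hom f ⊗ₘ hom g)

variable {C}

lemma src_tensorMor (f g : C.cat.Mor) :
    C.cat.src (tensorMor f g) = C.cat.src f * C.cat.src g := src_mor _

lemma tensorMor_mor {x y x' y' : C.cat.Obj} (f : x ⟶ y) (g : x' ⟶ y') :
    tensorMor (mor f) (mor g) = mor (f ⊗ₘ g) := mor_tensor f g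

lemma tensorMor_ident (x y : C.cat.Obj) :
    tensorMor (C.cat.ident x) (C.cat.ident y) = C.cat.ident (x * y) := by
  rw [← mor_id x, ← mor_id y, tensorMor_mor, id_tensorHom_id]
  rfl

/-- The composite of two morphisms with the same source, in a skeletal category. -/
def compMor (f g : C.cat.Mor) (h : C.cat.src f = C.cat.src g) : C.cat.Mor :=
  C.cat.comp ⟨(f, g), (tgt_eq_src f).trans h⟩

lemma compMor_mor {x y z : C.cat.Obj} (f : x ⟶ y) (g : y ⟶ z) (h) :
    compMor (mor f) (mor g) h = mor (f ≫ g) := rfl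

lemma src_compMor (f g : C.cat.Mor) (h) : C.cat.src (compMor f g h) = C.cat.src f :=
  C.cat.src_comp _

lemma ident_compMor (f : C.cat.Mor) {x : C.cat.Obj} (h) : compMor (C.cat.ident x) f h = f := by
  rw [C.cat.src_ident] at h
  subst h
  exact C.cat.ident_comp f

lemma compMor_ident (f : C.cat.Mor) {x : C.cat.Obj} (h) : compMor f (C.cat.ident x) h = f := by
  have h' : x = C.cat.tgt f := by rw [tgt_eq_src, h, C.cat.src_ident]
  subst h'
  exact C.cat.comp_ident f

/-- The endomorphism given by a morphism of a skeletal category. -/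
def endo (f : C.cat.Mor) {x : C.cat.Obj} (h : C.cat.src f = x) : x ⟶ x :=
  Hom.mk f h ((tgt_eq_src f).trans h)

lemma mor_endo (f : C.cat.Mor) {x : C.cat.Obj} (h : C.cat.src f = x) : mor (endo f h) = f := rfl

lemma tensorMor_compMor (f f' g g' : C.cat.Mor) (h : C.cat.src f = C.cat.src f')
    (h' : C.cat.src g = C.cat.src g') :
    tensorMor (compMor f f' h) (compMor g g' h') =
      compMor (tensorMor f g) (tensorMor f' g')
        (by rw [src_tensorMor, src_tensorMor, h, h']) := by
  have e : (endo f rfl ≫ endo f' h.symm) ⊗ₘ (endo g rfl ≫ endo g' h'.symm) =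
      (endo f rfl ⊗ₘ endo g rfl) ≫ (endo f' h.symm ⊗ₘ endo g' h'.symm) :=
    (tensorHom_comp_tensorHom _ _ _ _).symm
  have e' := congrArg mor e
  rw [← tensorMor_mor, mor_comp (endo f rfl ⊗ₘ endo g rfl)] at e'
  simp only [← tensorMor_mor] at e'
  exact e'

lemma one_tensorMor (f : C.cat.Mor) : tensorMor (C.cat.ident 1) f = f := by
  have e := congrArg mor (leftUnitor_naturality (hom f))
  rw [← id_tensorHom, mor_comp, mor_comp] at e
  simp only [C.leftUnitor_eq, ← tensorMor_mor] at e
  refine (compMor_ident _ ?_).symm.trans (e.trans (C.cat.ident_comp f))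
  rw [src_tensorMor, C.cat.src_ident, C.cat.src_ident, one_mul]
  exact (tgt_eq_src f).symm

lemma tensorMor_one (f : C.cat.Mor) : tensorMor f (C.cat.ident 1) = f := by
  have e := congrArg mor (rightUnitor_naturality (hom f))
  rw [← tensorHom_id, mor_comp, mor_comp] at e
  simp only [C.rightUnitor_eq, ← tensorMor_mor] at e
  refine (compMor_ident _ ?_).symm.trans (e.trans (C.cat.ident_comp f))
  rw [src_tensorMor, C.cat.src_ident, C.cat.src_ident, mul_one]
  exact (tgt_eq_src f).symm

/-- Eckmann-Hilton: composition of endomorphisms of the unit object is their tensor product. -/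
lemma compMor_eq_tensorMor (f g : C.cat.Mor) (hf : C.cat.src f = 1) (hg : C.cat.src g = 1) (h) :
    compMor f g h = tensorMor f g := by
  have := tensorMor_compMor f (C.cat.ident 1) (C.cat.ident 1) g
    (by rw [hf, C.cat.src_ident]) (by rw [hg, C.cat.src_ident])
  simp only [compMor_ident, ident_compMor, one_tensorMor, tensorMor_one] at this
  exact this.symm

lemma compMor_comm_one (f g : C.cat.Mor) (hf : C.cat.src f = 1) (hg : C.cat.src g = 1) (h) :
    compMor f g h = compMor g f h.symm := by
  have := tensorMor_compMor (C.cat.ident 1) f g (C.cat.ident 1)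
    (by rw [hf, C.cat.src_ident]) (by rw [hg, C.cat.src_ident])
  simp only [compMor_ident, ident_compMor, one_tensorMor, tensorMor_one] at this
  rw [compMor_eq_tensorMor f g hf hg, this]

lemma tensorMor_ident_compMor (f g : C.cat.Mor) (x : C.cat.Obj) (h) :
    tensorMor (compMor f g h) (C.cat.ident x) =
      compMor (tensorMor f (C.cat.ident x)) (tensorMor g (C.cat.ident x))
        (by rw [src_tensorMor, src_tensorMor, h]) := by
  rw [← tensorMor_compMor f g _ _ h rfl, ident_compMor]

lemma associator_naturality_mor (f g k : C.cat.Mor) {x y z : C.cat.Obj}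
    (hf : C.cat.src f = x) (hg : C.cat.src g = y) (hk : C.cat.src k = z) :
    compMor (tensorMor (tensorMor f g) k) (mor (α_ x y z).hom)
      (by rw [src_tensorMor, src_tensorMor, src_mor, hf, hg, hk]; rfl) =
    compMor (mor (α_ x y z).hom) (tensorMor f (tensorMor g k))
      (by rw [src_tensorMor, src_tensorMor, src_mor, ← mul_assoc, hf, hg, hk]; rfl) := by
  have e := congrArg mor (associator_naturality (endo f hf) (endo g hg) (endo k hk))
  rw [mor_comp, mor_comp] at e
  simp only [← tensorMor_mor] at e
  exact e

lemma compMor_left_cancel {x y : C.cat.Obj} (a : x ≅ y) (f g : C.cat.Mor) (hf hg)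
    (h : compMor (mor a.hom) f hf = compMor (mor a.hom) g hg) : f = g := by
  have hxy := eq_of_hom a.hom
  rw [src_mor] at hf hg
  have h1 : a.hom ≫ endo f (hf.symm.trans hxy) = a.hom ≫ endo g (hg.symm.trans hxy) :=
    mor_injective h
  exact congrArg mor ((Iso.cancel_iso_hom_left a _ _).1 h1)

lemma compMor_right_cancel {x y : C.cat.Obj} (a : x ≅ y) (f g : C.cat.Mor) (hf hg)
    (h : compMor f (mor a.hom) hf = compMor g (mor a.hom) hg) : f = g := by
  rw [src_mor] at hf hg
  have h1 : endo f hf ≫ a.hom = endo g hg ≫ a.hom := mor_injective h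
  exact congrArg mor ((Iso.cancel_iso_hom_right _ _ a).1 h1)

/-- Tensoring with an identity morphism on the right is faithful. -/
lemma tensorMor_ident_injective (f g : C.cat.Mor) (x : C.cat.Obj) (hfg : C.cat.src f = C.cat.src g)
    (h : tensorMor f (C.cat.ident x) = tensorMor g (C.cat.ident x)) : f = g := by
  have hf := associator_naturality_mor f (C.cat.ident x) (C.cat.ident x⁻¹) hfg (C.cat.src_ident x)
    (C.cat.src_ident x⁻¹)
  have hg := associator_naturality_mor g (C.cat.ident x) (C.cat.ident x⁻¹) rfl (C.cat.src_ident x)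
    (C.cat.src_ident x⁻¹)
  simp only [tensorMor_ident, mul_inv_cancel, tensorMor_one, h] at hf hg
  exact compMor_left_cancel _ _ _ _ _ (hf.symm.trans hg)

lemma compMor_comm (f g : C.cat.Mor) (h) : compMor f g h = compMor g f h.symm := by
  refine tensorMor_ident_injective _ _ (C.cat.src f)⁻¹ (by rw [src_compMor, src_compMor, h]) ?_
  rw [tensorMor_ident_compMor, tensorMor_ident_compMor, compMor_comm_one]
  · rw [src_tensorMor, C.cat.src_ident, mul_inv_cancel]
  · rw [src_tensorMor, C.cat.src_ident, h, mul_inv_cancel]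

/-- In a special topological 2-group, the tensor product of morphisms is strictly associative
(although the associator may be nontrivial). -/
lemma tensorMor_assoc (f g k : C.cat.Mor) :
    tensorMor (tensorMor f g) k = tensorMor f (tensorMor g k) := by
  have e := associator_naturality_mor f g k rfl rfl rfl
  rw [compMor_comm] at e
  exact compMor_left_cancel _ _ _ _ _ e

/-- The inverse functor on the space of morphisms. -/
def invMor (f : C.cat.Mor) : C.cat.Mor := mor (C.inv.map (hom f))

lemma src_invMor (f : C.cat.Mor) : C.cat.src (invMor f) = (C.cat.src f)⁻¹ := src_mor _

lemma invMor_tensorMor (f : C.cat.Mor) : tensorMor (invMor f) f = C.cat.ident 1 := by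
  have e := congrArg mor (C.counit_naturality (hom f))
  rw [mor_comp] at e
  simp only [C.counit_eq, ← tensorMor_mor] at e
  refine (compMor_ident _ ?_).symm.trans e
  rw [src_tensorMor, C.cat.src_ident]
  exact (congrArg (· * _) (src_invMor f)).trans (inv_mul_cancel (C.cat.src f))

variable (C)

/-- The endomorphisms of the unit object, with the subspace topology. (In a skeletal category an
endomorphism of `1` is a morphism with source `1`.) -/
abbrev UnitEnd : Type u := {h : C.cat.Mor // C.cat.src h = 𝟙_ C.cat.Obj}

/-- Addition of endomorphisms of the unit object is composition. -/
instance : Add C.UnitEnd where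
  add h k := ⟨compMor h.1 k.1 (h.2.trans k.2.symm), (src_compMor _ _ _).trans h.2⟩

variable {C} in
lemma UnitEnd.coe_add' (h k : C.UnitEnd) :
    (h + k).1 = compMor h.1 k.1 (h.2.trans k.2.symm) := rfl

variable {C} in
lemma UnitEnd.coe_add (h k : C.UnitEnd) : (h + k).1 = tensorMor h.1 k.1 :=
  compMor_eq_tensorMor _ _ h.2 k.2 (h.2.trans k.2.symm)

instance : Zero C.UnitEnd where
  zero := ⟨C.cat.ident (𝟙_ C.cat.Obj), C.cat.src_ident _⟩

instance : Neg C.UnitEnd where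
  neg h := ⟨invMor h.1, (src_invMor h.1).trans (by rw [h.2]; exact inv_one)⟩

/-- The abelian group of endomorphisms of the unit object, written additively: the operation is
composition. -/
instance unitEndAddCommGroup : AddCommGroup C.UnitEnd where
  add_assoc h k l := Subtype.ext (by simp only [UnitEnd.coe_add, tensorMor_assoc])
  zero_add h := Subtype.ext ((UnitEnd.coe_add 0 h).trans (one_tensorMor h.1))
  add_zero h := Subtype.ext ((UnitEnd.coe_add h 0).trans (tensorMor_one h.1))
  add_comm h k := Subtype.ext (by
    rw [UnitEnd.coe_add', UnitEnd.coe_add', compMor_comm])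
  neg_add_cancel h := Subtype.ext ((UnitEnd.coe_add (-h) h).trans (invMor_tensorMor h.1))
  nsmul := nsmulRec
  zsmul := zsmulRec

variable {C}

lemma continuous_tensorMor {T : Type*} [TopologicalSpace T] {f g : T → C.cat.Mor}
    (hf : Continuous f) (hg : Continuous g) : Continuous fun t => tensorMor (f t) (g t) :=
  C.continuous_tensorHom.comp (hf.prodMk hg)

instance : IsTopologicalAddGroup C.UnitEnd where
  continuous_add := by
    have h : Continuous fun p : C.UnitEnd × C.UnitEnd => tensorMor p.1.1 p.2.1 :=
      continuous_tensorMor (continuous_subtype_val.comp continuous_fst)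
        (continuous_subtype_val.comp continuous_snd)
    refine continuous_induced_rng.2 (h.congr fun p => ?_)
    exact (UnitEnd.coe_add p.1 p.2).symm
  continuous_neg := (C.continuous_inv.continuous_map.comp continuous_subtype_val).subtype_mk _

/-- The action `α(g, h) = (1_g ⊗ h) ⊗ 1_{inv g}` of the group of objects on the group of endomorphisms
of the unit object. -/
instance : SMul C.cat.Obj C.UnitEnd where
  smul g h := ⟨tensorMor (tensorMor (C.cat.ident g) h.1) (C.cat.ident (C.inv.obj g)), by
    rw [src_tensorMor, src_tensorMor, h.2, C.cat.src_ident, C.cat.src_ident]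
    exact (congrArg (· * g⁻¹) (mul_one g)).trans (mul_inv_cancel g)⟩

lemma UnitEnd.coe_smul (g : C.cat.Obj) (h : C.UnitEnd) :
    (g • h).1 = tensorMor (tensorMor (C.cat.ident g) h.1) (C.cat.ident g⁻¹) := rfl

instance : DistribMulAction C.cat.Obj C.UnitEnd where
  one_smul h := Subtype.ext (by
    rw [UnitEnd.coe_smul, one_tensorMor, inv_one, tensorMor_one])
  mul_smul g k h := Subtype.ext (by
    simp only [UnitEnd.coe_smul, mul_inv_rev, ← tensorMor_ident, tensorMor_assoc])
  smul_zero g := Subtype.ext (by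
    refine (UnitEnd.coe_smul g 0).trans ?_
    change tensorMor (tensorMor (C.cat.ident g) (C.cat.ident 1)) (C.cat.ident g⁻¹) = C.cat.ident 1
    rw [tensorMor_one, tensorMor_ident, mul_inv_cancel])
  smul_add g h k := Subtype.ext (by
    simp only [UnitEnd.coe_smul, UnitEnd.coe_add, tensorMor_assoc]
    rw [← tensorMor_assoc (C.cat.ident g⁻¹), tensorMor_ident, inv_mul_cancel, one_tensorMor])

instance : ContinuousSMul C.cat.Obj C.UnitEnd where
  continuous_smul := (continuous_tensorMor (continuous_tensorMor
    (C.cat.continuous_ident.comp continuous_fst) (continuous_subtype_val.comp continuous_snd))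
    (C.cat.continuous_ident.comp (C.continuous_inv.continuous_obj.comp continuous_fst))).subtype_mk
      _

end SpecialTopologicalTwoGroup

/-! ### Continuous group cohomology -/

section ContinuousCohomology

variable (G A : Type*) [Group G] [TopologicalSpace G] [IsTopologicalGroup G]
  [AddCommGroup A] [TopologicalSpace A] [IsTopologicalAddGroup A]
  [DistribMulAction G A] [ContinuousSMul G A]

lemma continuous_contractNth {n : ℕ} (j : Fin (n + 1)) :
    Continuous fun g : Fin (n + 1) → G => Fin.contractNth j (· * ·) g := by
  refine continuous_pi fun k => ?_
  unfold Fin.contractNth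
  split_ifs <;> fun_prop

/-- The differential of the complex of continuous inhomogeneous cochains `Gⁿ → A`:
`(d f)(g₀, …, gₙ) = g₀ f(g₁, …, gₙ) + ∑ⱼ (-1)^(j+1) f(g₀, …, gⱼ gⱼ₊₁, …, gₙ)`, the last summand
(`j = n`) being `(-1)^(n+1) f(g₀, …, gₙ₋₁)`. -/
def contCochainD (n : ℕ) : C(Fin n → G, A) →+ C(Fin (n + 1) → G, A) where
  toFun f :=
    { toFun := fun g => g 0 • f (fun i => g i.succ) +
        ∑ j : Fin (n + 1), (-1 : ℤ) ^ ((j : ℕ) + 1) • f (Fin.contractNth j (· * ·) g)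
      continuous_toFun := by
        have h := fun j : Fin (n + 1) => f.continuous.comp (continuous_contractNth G j)
        refine Continuous.add (by fun_prop) (continuous_finsetSum _ fun j _ => ?_)
        exact Continuous.const_smul (h j) ((-1 : ℤ) ^ ((j : ℕ) + 1)) }
  map_zero' := by ext; simp
  map_add' f f' := by
    ext g
    simp only [ContinuousMap.coe_mk, ContinuousMap.add_apply, smul_add, Finset.sum_add_distrib]
    abel

/-- Continuous `n`-cocycles. -/
def contCocycles (n : ℕ) : AddSubgroup C(Fin n → G, A) := (contCochainD G A n).ker

/-- Continuous `n`-coboundaries. -/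
def contCoboundaries : (n : ℕ) → AddSubgroup C(Fin n → G, A)
  | 0 => ⊥
  | n + 1 => (contCochainD G A n).range

/-- Continuous cohomology `Hⁿ_cont(G, A)`: continuous cocycles modulo continuous
coboundaries. -/
abbrev ContCohomology (n : ℕ) : Type _ :=
  contCocycles G A n ⧸ (contCoboundaries G A n).addSubgroupOf (contCocycles G A n)

end ContinuousCohomology

/-! ### The class of the associator -/

namespace SpecialTopologicalTwoGroup

variable {C : SpecialTopologicalTwoGroup.{u}}

/-- The identification of the endomorphisms of an arbitrary object `x` with those of the unit
object, by tensoring with the identity of `inv x` on the right. -/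
def toUnitEnd (f : C.cat.Mor) : C.UnitEnd :=
  ⟨tensorMor f (C.cat.ident (C.inv.obj (C.cat.src f))), by
    rw [src_tensorMor, C.cat.src_ident]
    exact mul_inv_cancel (C.cat.src f)⟩

lemma coe_toUnitEnd (f : C.cat.Mor) :
    (toUnitEnd f).1 = tensorMor f (C.cat.ident (C.cat.src f)⁻¹) := rfl

lemma toUnitEnd_compMor (f g : C.cat.Mor) (h) :
    toUnitEnd (compMor f g h) = toUnitEnd f + toUnitEnd g := by
  refine Subtype.ext ?_
  rw [coe_toUnitEnd, src_compMor, tensorMor_ident_compMor]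
  rw [UnitEnd.coe_add']
  simp only [coe_toUnitEnd, h]

lemma toUnitEnd_tensor_ident (f : C.cat.Mor) (x : C.cat.Obj) :
    toUnitEnd (tensorMor f (C.cat.ident x)) = toUnitEnd f := by
  refine Subtype.ext ?_
  rw [coe_toUnitEnd, coe_toUnitEnd, tensorMor_assoc, tensorMor_ident, src_tensorMor,
    C.cat.src_ident, mul_inv_rev, mul_inv_cancel_left]

lemma toUnitEnd_ident_tensor (f : C.cat.Mor) (x : C.cat.Obj) :
    toUnitEnd (tensorMor (C.cat.ident x) f) = x • toUnitEnd f := by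
  refine Subtype.ext ?_
  rw [UnitEnd.coe_smul, coe_toUnitEnd, coe_toUnitEnd, src_tensorMor, C.cat.src_ident, mul_inv_rev]
  simp only [← tensorMor_ident, tensorMor_assoc]

variable (C)

/-- The associator as a continuous map `G³ → H`, where `G` is the group of objects and `H` the
group of endomorphisms of the unit object. -/
def associatorCochain : C(Fin 3 → C.cat.Obj, C.UnitEnd) where
  toFun g := toUnitEnd (mor (α_ (g 0) (g 1) (g 2)).hom)
  continuous_toFun := by
    have h : Continuous fun g : Fin 3 → C.cat.Obj => mor (α_ (g 0) (g 1) (g 2)).hom :=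
      C.continuous_associator_hom.comp (g := fun p : C.cat.Obj × C.cat.Obj × C.cat.Obj =>
        mor (α_ p.1 p.2.1 p.2.2).hom) (f := fun g : Fin 3 → C.cat.Obj => (g 0, g 1, g 2))
        (by fun_prop)
    exact (continuous_tensorMor h (C.cat.continuous_ident.comp
      (C.continuous_inv.continuous_obj.comp (C.cat.continuous_src.comp h)))).subtype_mk _

/-- The pentagon identity says that the associator is a 3-cocycle. -/
lemma associatorCochain_mem : C.associatorCochain ∈ contCocycles C.cat.Obj C.UnitEnd 3 := by
  have key : ∀ w x y z : C.cat.Obj,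
      toUnitEnd (mor (α_ w x y).hom) + (toUnitEnd (mor (α_ w (x * y) z).hom) +
        w • toUnitEnd (mor (α_ x y z).hom)) =
      toUnitEnd (mor (α_ (w * x) y z).hom) + toUnitEnd (mor (α_ w x (y * z)).hom) := by
    intro w x y z
    have e := congrArg (fun f => toUnitEnd (mor f)) (pentagon w x y z)
    have c : ∀ {p q r : C.cat.Obj} (f : p ⟶ q) (g : q ⟶ r),
        toUnitEnd (mor (f ≫ g)) = toUnitEnd (mor f) + toUnitEnd (mor g) := fun f g =>
      toUnitEnd_compMor (mor f) (mor g) (by rw [src_mor, src_mor]; exact eq_of_hom f)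
    rw [c, c, c, ← tensorHom_id, ← id_tensorHom, ← tensorMor_mor, ← tensorMor_mor, mor_id, mor_id,
      toUnitEnd_tensor_ident, toUnitEnd_ident_tensor] at e
    exact e
  refine (AddMonoidHom.mem_ker).2 ?_
  ext1 g
  have e := key (g 0) (g 1) (g 2) (g 3)
  change g 0 • toUnitEnd (mor (α_ (g 1) (g 2) (g 3)).hom) + ∑ j : Fin 4, _ = 0
  rw [Fin.sum_univ_four]
  change _ + (_ • toUnitEnd (mor (α_ (g 0 * g 1) (g 2) (g 3)).hom) +
    _ • toUnitEnd (mor (α_ (g 0) (g 1 * g 2) (g 3)).hom) +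
    _ • toUnitEnd (mor (α_ (g 0) (g 1) (g 2 * g 3)).hom) +
    _ • toUnitEnd (mor (α_ (g 0) (g 1) (g 2)).hom)) = _
  have e' := sub_eq_zero.2 e
  refine Eq.trans ?_ e'
  norm_num
  abel

/-- The class `[a]` of the associator in the continuous cohomology group `H³_cont(G, H)`. -/
def associatorClass : ContCohomology C.cat.Obj C.UnitEnd 3 :=
  QuotientAddGroup.mk ⟨C.associatorCochain, C.associatorCochain_mem⟩

end SpecialTopologicalTwoGroup

/-! The universal covering of a connected abelian Lie group `H` is a finite-dimensional vector space
`V`; what is needed of it is a continuous homomorphism `p : V → H` that is invertible near zero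
(`IsExponential`). For continuous cochains with values in `V`, a compact group has no cohomology in
degree 3: integrating the cocycle identity over its last variable against Haar measure exhibits the
cocycle as a coboundary. So the aim is to lift the associator cocycle from `H` to `V`.

A map `G³ → H` need not lift, since `G` may have loops. All loops in `G³` come, up to homotopy, from
the three axes, so the obstruction disappears once the cocycle vanishes on each axis, and an
explicit coboundary achieves this. The action of `G` lifts to linear maps of `V`. The differential
of the lifted cochain takes values in the discrete group `ker p` and `G⁴` is connected, so this
differential is a constant fixed by `G`. Subtracting that constant from the lift leaves a genuine
cocycle in `V`; averaging it and applying `p` gives a continuous `b` with `a = db`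
(`IsExponential.exists_primitive`).

The exponential comes from a logarithm of the group law in a chart (`exists_local_logarithm`): the
invariant 1-form of a commutative group law is closed, hence has a local primitive, which is a local
homomorphism to `V`. Its local inverse extends to all of `V` by `v ↦ n • ψ (v / n)`.

For the second claim, tensoring of morphisms in a special 2-group is strictly associative, so
replacing the associator by the identity gives another special 2-group, `strictification`. The
identity functor becomes monoidal between the two when its multiplication constraint is the
normalised `b`, because its coherence condition is exactly `a = db`; using `-b` gives the inverse.
-/

/-! ### The logarithm of a commutative local group law -/

section LocalLogarithm

open Filter Topology ContinuousLinearMap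

variable {E : Type*} [NormedAddCommGroup E] [NormedSpace ℝ E]

/-- Mixed partial derivatives of a symmetric function of two variables form a symmetric bilinear
map. -/
lemma mixed_partials_symmetric {F : E × E → E} (hF : ContDiffAt ℝ 2 F (0, 0))
    (hsymm : ∀ᶠ p : E × E in 𝓝 (0, 0), F p.swap = F p) {g : E → E →L[ℝ] E}
    {g' : E →L[ℝ] E →L[ℝ] E}
    (hg : ∀ᶠ y in 𝓝 (0 : E), HasFDerivAt (fun z => F (z, y)) (g y) 0)
    (hg' : HasFDerivAt g g' 0) (u v : E) : g' u v = g' v u := by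
  have hF1 : ∀ᶠ p in 𝓝 ((0, 0) : E × E), DifferentiableAt ℝ F p :=
    (hF.eventually (by simp)).mono fun p hp => hp.differentiableAt (by simp)
  have hD : DifferentiableAt ℝ (fderiv ℝ F) (0, 0) :=
    (hF.fderiv_right (m := 1) (by norm_num)).differentiableAt (by simp)
  -- This identifies `g'` with the mixed block of the second derivative of `F`: the first slot
  -- differentiates in `y`, the second in `z`.
  have key : ∀ u v : E, fderiv ℝ (fderiv ℝ F) (0, 0) (0, v) (u, 0) = g' v u := by
    intro u v
    have h1 : HasFDerivAt (fun y : E => (0, y)) (inr ℝ E E) 0 := (inr ℝ E E).hasFDerivAt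
    have h2 : HasFDerivAt (fun y : E => (fderiv ℝ F (0, y)) (u, 0))
        (((fderiv ℝ (fderiv ℝ F) (0, 0)).comp (inr ℝ E E)).flip (u, 0)) 0 := by
      have h3 : HasFDerivAt (fun y : E => fderiv ℝ F (0, y))
          ((fderiv ℝ (fderiv ℝ F) (0, 0)).comp (inr ℝ E E)) 0 :=
        HasFDerivAt.comp (0 : E) (g := fderiv ℝ F) (f := fun y : E => (0, y)) hD.hasFDerivAt h1
      simpa using h3.clm_apply (hasFDerivAt_const ((u, 0) : E × E) (0 : E))
    have h4 : HasFDerivAt (fun y : E => g y u) (g'.flip u) 0 := by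
      simpa using hg'.clm_apply (hasFDerivAt_const u (0 : E))
    have h5 : (fun y : E => (fderiv ℝ F (0, y)) (u, 0)) =ᶠ[𝓝 0] fun y => g y u := by
      have hF2 : ∀ᶠ y in 𝓝 (0 : E), DifferentiableAt ℝ F (0, y) :=
        (h1.continuousAt.tendsto.eventually hF1)
      filter_upwards [hF2, hg] with y hy hgy
      have h6 : HasFDerivAt (fun z : E => (z, y)) (inl ℝ E E) 0 := hasFDerivAt_prodMk_left 0 y
      have h7 := (HasFDerivAt.comp (0 : E) (g := F) (f := fun z : E => (z, y))
        hy.hasFDerivAt h6).unique hgy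
      simpa using congrArg (fun L => L u) h7
    have h8 := h2.unique (h4.congr_of_eventuallyEq h5)
    simpa using congrArg (fun L => L v) h8
  have hS : ∀ᶠ p in 𝓝 ((0, 0) : E × E),
      fderiv ℝ F p = (fderiv ℝ F p.swap).comp
        (ContinuousLinearEquiv.prodComm ℝ E E : E × E →L[ℝ] E × E) := by
    have hc : Tendsto (Prod.swap : E × E → E × E) (𝓝 (0, 0)) (𝓝 (0, 0)) :=
      (continuous_swap.tendsto _)
    filter_upwards [hsymm.eventually_nhds, hc.eventually hF1] with p hp hd
    have e : F =ᶠ[𝓝 p] F ∘ (ContinuousLinearEquiv.prodComm ℝ E E) :=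
      hp.mono fun q hq => hq.symm
    rw [e.fderiv_eq]
    exact (HasFDerivAt.comp p (g := F) hd.hasFDerivAt
      (ContinuousLinearEquiv.prodComm ℝ E E).hasFDerivAt).fderiv
  have swap : ∀ a b : E × E, fderiv ℝ (fderiv ℝ F) (0, 0) a b =
      fderiv ℝ (fderiv ℝ F) (0, 0) a.swap b.swap := by
    intro a b
    have h1 : HasFDerivAt (fun p => fderiv ℝ F p b)
        ((fderiv ℝ (fderiv ℝ F) (0, 0)).flip b) (0, 0) := by
      simpa using hD.hasFDerivAt.clm_apply (hasFDerivAt_const b ((0, 0) : E × E))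
    have h2 : HasFDerivAt (fun p : E × E => fderiv ℝ F p.swap b.swap)
        (((fderiv ℝ (fderiv ℝ F) (0, 0)).flip b.swap).comp
          (ContinuousLinearEquiv.prodComm ℝ E E : E × E →L[ℝ] E × E)) (0, 0) := by
      have h3 : HasFDerivAt (fun p => fderiv ℝ F p b.swap)
          ((fderiv ℝ (fderiv ℝ F) (0, 0)).flip b.swap) (0, 0) := by
        simpa using hD.hasFDerivAt.clm_apply (hasFDerivAt_const b.swap ((0, 0) : E × E))
      exact HasFDerivAt.comp ((0, 0) : E × E) (f := Prod.swap) h3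
        (ContinuousLinearEquiv.prodComm ℝ E E).hasFDerivAt
    have h4 := h1.unique (h2.congr_of_eventuallyEq (hS.mono fun p hp =>
      congrArg (fun L => L b) hp))
    simpa using congrArg (fun L => L a) h4
  -- Exchanging the two variables of `F` and then the order of differentiation turns the block at
  -- `(u, v)` into the block at `(v, u)`.
  have hsym := hF.isSymmSndFDerivAt (by simp)
  rw [← key, ← key, swap, hsym]
  simp

/-- A commutative local group law on a Banach space admits a logarithm: a map to the additive group
which is tangent to the identity and is a local homomorphism. -/
theorem exists_local_logarithm [CompleteSpace E] {m : E × E → E}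
    (hm : ContDiffAt ℝ 3 m (0, 0)) (hzero : ∀ᶠ x in 𝓝 (0 : E), m (x, 0) = x)
    (hcomm : ∀ᶠ p : E × E in 𝓝 (0, 0), m p.swap = m p)
    (hassoc : ∀ᶠ p : E × E × E in 𝓝 (0, 0, 0),
      m (m (p.1, p.2.1), p.2.2) = m (p.1, m (p.2.1, p.2.2))) :
    ∃ φ : E → E, φ 0 = 0 ∧ HasStrictFDerivAt φ (ContinuousLinearMap.id ℝ E) 0 ∧
      ∀ᶠ p : E × E in 𝓝 (0, 0), φ (m p) = φ p.1 + φ p.2 := by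
  have hm0 : m (0, 0) = 0 := hzero.self_of_nhds
  have hmc : Tendsto m (𝓝 (0, 0)) (𝓝 0) := by simpa [ContinuousAt, hm0] using hm.continuousAt
  have hm3 : ∀ᶠ p in 𝓝 ((0, 0) : E × E), ContDiffAt ℝ 3 m p := hm.eventually (by simp)
  have tl : Tendsto (fun x : E => (x, (0 : E))) (𝓝 0) (𝓝 (0, 0)) :=
    (Continuous.prodMk_left (0 : E)).tendsto 0
  -- `A x u` is the value at `x` of the invariant vector field that equals `u` at the origin. Its
  -- inverse `B` below is the invariant 1-form, the future derivative of the logarithm.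
  let A : E → E →L[ℝ] E := fun x => (fderiv ℝ m (x, 0)).comp (inr ℝ E E)
  have hA : ContDiffAt ℝ 2 A 0 := by
    have h1 : ContDiffAt ℝ 2 (fderiv ℝ m) (0, 0) := hm.fderiv_right (by norm_num)
    have h2 : ContDiffAt ℝ 2 (fun x : E => fderiv ℝ m (x, 0)) 0 :=
      ContDiffAt.comp (0 : E) (g := fderiv ℝ m) (f := fun x : E => (x, (0 : E))) h1
        (contDiffAt_id.prodMk contDiffAt_const)
    exact h2.clm_comp contDiffAt_const
  have hAm : ∀ᶠ x in 𝓝 (0 : E), HasFDerivAt (fun y => m (x, y)) (A x) 0 := by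
    filter_upwards [tl.eventually hm3] with x hx
    exact HasFDerivAt.comp (0 : E) (g := m) (f := fun y => (x, y))
      (hx.differentiableAt (by simp)).hasFDerivAt (hasFDerivAt_prodMk_right x 0)
  have hAm' : ∀ᶠ x in 𝓝 (0 : E), HasFDerivAt (fun y => m (y, x)) (A x) 0 := by
    filter_upwards [hAm, tl.eventually hcomm.eventually_nhds] with x hx hc
    refine hx.congr_of_eventuallyEq ?_
    have := (Continuous.prodMk_right x).tendsto (0 : E) |>.eventually hc
    exact this.mono fun y hy => hy
  have hzero' : ∀ᶠ x in 𝓝 (0 : E), m (0, x) = x := by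
    filter_upwards [hzero, tl.eventually hcomm] with x h1 h2
    exact h2.trans h1
  have hA0 : A 0 = ContinuousLinearMap.id ℝ E :=
    hAm.self_of_nhds.unique ((hasFDerivAt_id (0 : E)).congr_of_eventuallyEq hzero')
  -- invertibility
  have hAinv : ∀ᶠ x in 𝓝 (0 : E), (A x).IsInvertible := by
    have h1 : ∀ᶠ L in 𝓝 (A 0), L.IsInvertible := by
      rw [hA0]
      exact (ContinuousLinearEquiv.nhds (ContinuousLinearEquiv.refl ℝ E))
    exact hA.continuousAt.tendsto.eventually h1
  let B : E → E →L[ℝ] E := fun x => (A x).inverse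
  have hB0 : B 0 = ContinuousLinearMap.id ℝ E := by
    simp only [B, hA0, ContinuousLinearMap.inverse_id]
  have hB : ContDiffAt ℝ 1 B 0 := by
    have h1 : ContDiffAt ℝ 1 (ContinuousLinearMap.inverse : (E →L[ℝ] E) → E →L[ℝ] E) (A 0) := by
      rw [hA0]
      exact contDiffAt_map_inverse (ContinuousLinearEquiv.refl ℝ E)
    exact ContDiffAt.comp (0 : E) h1 (hA.of_le (by norm_num))
  have hBd : ∀ᶠ x in 𝓝 (0 : E), ContDiffAt ℝ 1 B x := hB.eventually (by simp)
  have hAd : ∀ᶠ x in 𝓝 (0 : E), ContDiffAt ℝ 2 A x := hA.eventually (by simp)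
  have hBA : ∀ᶠ x in 𝓝 (0 : E), (B x).comp (A x) = ContinuousLinearMap.id ℝ E :=
    hAinv.mono fun x hx => hx.inverse_comp_self
  have hAB : ∀ᶠ x in 𝓝 (0 : E), (A x).comp (B x) = ContinuousLinearMap.id ℝ E :=
    hAinv.mono fun x hx => hx.self_comp_inverse
  -- the invariant vector fields commute
  have hAsymm : ∀ᶠ x in 𝓝 (0 : E), ∀ u v, fderiv ℝ A x (A x u) v = fderiv ℝ A x (A x v) u := by
    have t3 : Tendsto (fun x : E => ((0 : E), (0 : E), x)) (𝓝 0) (𝓝 (0, 0, 0)) :=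
      Continuous.tendsto (by fun_prop) 0
    have tr : Tendsto (fun x : E => ((0 : E), x)) (𝓝 0) (𝓝 (0, 0)) :=
      (Continuous.prodMk_right (0 : E)).tendsto 0
    have hm0x : ∀ᶠ x in 𝓝 (0 : E), ContDiffAt ℝ 3 m (0, x) := tr.eventually hm3
    filter_upwards [hAm', hAd, hzero', hm0x, t3.eventually hassoc.eventually_nhds,
      hAm'.eventually_nhds] with x hx hdx h0x hmx hax hAx u v
    have hg : HasFDerivAt (fun y => A (m (y, x))) ((fderiv ℝ A x).comp (A x)) 0 := by
      refine HasFDerivAt.comp (0 : E) (g := A) (f := fun y => m (y, x)) ?_ hx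
      rw [h0x]
      exact (hdx.differentiableAt (by simp)).hasFDerivAt
    have hmyx : Tendsto (fun y => m (y, x)) (𝓝 0) (𝓝 x) := by
      have := hx.continuousAt.tendsto
      rwa [h0x] at this
    -- By associativity and commutativity `m (y, m (z, x))` is symmetric in `y` and `z`. Its
    -- derivative in the first variable at `0` is `A (m (z, x))`, whose derivative in `z` at `0` is
    -- `DA(x) ∘ A(x)`.
    refine mixed_partials_symmetric (F := fun p => m (p.1, m (p.2, x))) ?_ ?_ ?_ hg u v
    · refine ContDiffAt.comp ((0, 0) : E × E) (g := m) ?_ (contDiffAt_fst.prodMk ?_)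
      · simp only [h0x]
        exact hmx.of_le (by norm_num)
      · exact ContDiffAt.comp ((0, 0) : E × E) (g := m) (f := fun p : E × E => (p.2, x))
          (hmx.of_le (by norm_num)) (contDiffAt_snd.prodMk contDiffAt_const)
    · have t4 : Tendsto (fun p : E × E => (p.1, p.2, x)) (𝓝 (0, 0)) (𝓝 (0, 0, x)) :=
        Continuous.tendsto (by fun_prop) (0, 0)
      have t5 : Tendsto (fun p : E × E => (p.2, p.1, x)) (𝓝 (0, 0)) (𝓝 (0, 0, x)) :=
        Continuous.tendsto (by fun_prop) (0, 0)
      filter_upwards [t4.eventually hax, t5.eventually hax, hcomm] with p h1 h2 h3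
      refine h2.symm.trans (Eq.trans ?_ h1)
      exact congrArg (fun w => m (w, x)) h3
    · exact hmyx.eventually hAx
  -- hence the invariant 1-form is closed
  have hBsymm : ∀ᶠ x in 𝓝 (0 : E), ∀ u v, fderiv ℝ B x u v = fderiv ℝ B x v u := by
    filter_upwards [hAsymm, hBA.eventually_nhds, hAB, hBd, hAd] with x hs hba hab hb ha u v
    have hd := ((hb.differentiableAt (by simp)).hasFDerivAt.clm_comp
      (ha.differentiableAt (by simp)).hasFDerivAt).unique
      ((hasFDerivAt_const (ContinuousLinearMap.id ℝ E) x).congr_of_eventuallyEq hba)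
    have hab' : ∀ w, A x (B x w) = w := fun w => congrArg (fun L => L w) hab
    -- The derivative of an inverse, `DB = -B (DA) B`. Evaluated on the vectors `A x u` and `A x v`
    -- it reduces closedness of `B` to the symmetry `hs`.
    have h1 : ∀ h k, fderiv ℝ B x h k = - B x (fderiv ℝ A x h (B x k)) := by
      intro h k
      have h2 := congrArg (fun L => L h (B x k)) hd
      simp only [add_apply, ContinuousLinearMap.comp_apply, compL_apply, flip_apply,
        zero_apply, hab'] at h2
      exact eq_neg_of_add_eq_zero_right h2
    rw [h1, h1, ← hab' u, ← hab' v, hs]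
    simp only [hab']
  -- invariance
  have hinv : ∀ᶠ p in 𝓝 ((0, 0) : E × E), ∃ L : E →L[ℝ] E,
      HasFDerivAt (fun y => m (p.1, y)) L p.2 ∧ (B (m p)).comp L = B p.2 := by
    have t3 : Tendsto (fun p : E × E => (p.1, p.2, (0 : E))) (𝓝 (0, 0)) (𝓝 (0, 0, 0)) :=
      Continuous.tendsto (by fun_prop) (0, 0)
    have ts : Tendsto (fun p : E × E => p.2) (𝓝 (0, 0)) (𝓝 0) := continuous_snd.tendsto (0, 0)
    filter_upwards [hm3, t3.eventually hassoc.eventually_nhds, hmc.eventually hAm,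
      hmc.eventually hBA, ts.eventually hAB, ts.eventually hAm, ts.eventually hzero]
      with p hp ha hAp hBp hAB2 hA2 hz
    have hL : HasFDerivAt (fun y => m (p.1, y)) ((fderiv ℝ m p).comp (inr ℝ E E)) p.2 :=
      HasFDerivAt.comp p.2 (g := m) (f := fun y => (p.1, y))
        (hp.differentiableAt (by simp)).hasFDerivAt (hasFDerivAt_prodMk_right p.1 p.2)
    refine ⟨_, hL, ?_⟩
    -- Differentiating `p.1 (p.2 z) = (p.1 p.2) z` at `z = 0` gives `L ∘ A (p.2) = A (m p)` for the
    -- derivative `L` of translation by `p.1`, which is invariance of `B` after inverting.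
    have h1 : HasFDerivAt (fun z => m (p.1, m (p.2, z)))
        (((fderiv ℝ m p).comp (inr ℝ E E)).comp (A p.2)) 0 := by
      refine HasFDerivAt.comp (0 : E) (g := fun y => m (p.1, y)) (f := fun z => m (p.2, z)) ?_ hA2
      rw [hz]
      exact hL
    have h2 : (fun z => m (p.1, m (p.2, z))) =ᶠ[𝓝 0] fun z => m (m p, z) := by
      have t6 : Tendsto (fun z : E => (p.1, p.2, z)) (𝓝 0) (𝓝 (p.1, p.2, 0)) :=
        Continuous.tendsto (by fun_prop) 0
      exact (t6.eventually ha).mono fun z hz => hz.symm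
    have h3 : ((fderiv ℝ m p).comp (inr ℝ E E)).comp (A p.2) = A (m p) :=
      h1.unique (hAp.congr_of_eventuallyEq h2)
    calc (B (m p)).comp ((fderiv ℝ m p).comp (inr ℝ E E))
        = ((B (m p)).comp (((fderiv ℝ m p).comp (inr ℝ E E)).comp (A p.2))).comp (B p.2) := by
          rw [comp_assoc, comp_assoc, hAB2, comp_id]
      _ = B p.2 := by rw [h3, hBp, id_comp]
  obtain ⟨r, hr, hball⟩ := Metric.eventually_nhds_iff_ball.1 (hBd.and hBsymm)
  -- Poincaré lemma: on a ball the closed form `B` has a primitive.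
  obtain ⟨φ₀, hφ₀⟩ := (convex_ball (0 : E) r).exists_forall_hasFDerivAt_of_fderiv_symmetric
    Metric.isOpen_ball
    (fun x hx => ((hball x hx).1.differentiableAt (by simp)).differentiableWithinAt)
    (fun x hx => (hball x hx).2)
  let φ : E → E := fun x => φ₀ x - φ₀ 0
  have hφ : ∀ x ∈ Metric.ball (0 : E) r, HasFDerivAt φ (B x) x := fun x hx =>
    (hφ₀ x hx).sub_const _
  refine ⟨φ, sub_self _, ?_, ?_⟩
  · rw [← hB0]
    refine hasStrictFDerivAt_of_hasFDerivAt_of_continuousAt ?_ hB.continuousAt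
    filter_upwards [Metric.ball_mem_nhds (0 : E) hr] with x hx using hφ x hx
  · have hmr : ∀ᶠ p in 𝓝 ((0, 0) : E × E), m p ∈ Metric.ball (0 : E) r :=
      hmc.eventually (Metric.ball_mem_nhds (0 : E) hr)
    have tf : Tendsto (fun p : E × E => p.1) (𝓝 (0, 0)) (𝓝 0) := continuous_fst.tendsto (0, 0)
    obtain ⟨δ, hδ, hδb⟩ := Metric.eventually_nhds_iff_ball.1
      ((hmr.and hinv).and (tf.eventually hzero))
    filter_upwards [Metric.ball_mem_nhds ((0, 0) : E × E) (lt_min hδ hr)] with p hp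
    have hp' : p.1 ∈ Metric.ball (0 : E) (min δ r) ∧ p.2 ∈ Metric.ball (0 : E) (min δ r) := by
      rw [← ball_prod_same] at hp
      exact hp
    -- Invariance of `B` says that `y ↦ φ (m (x, y)) - φ y` has zero derivative; being constant on a
    -- ball, it equals its value `φ x` at `y = 0`.
    have hd : ∀ y ∈ Metric.ball (0 : E) (min δ r),
        HasFDerivAt (fun y => φ (m (p.1, y)) - φ y) (0 : E →L[ℝ] E) y := by
      intro y hy
      have hpy : (p.1, y) ∈ Metric.ball ((0, 0) : E × E) δ := by
        rw [← ball_prod_same]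
        exact ⟨Metric.ball_subset_ball (min_le_left _ _) hp'.1,
          Metric.ball_subset_ball (min_le_left _ _) hy⟩
      obtain ⟨⟨h1, L, h2, h3⟩, -⟩ := hδb _ hpy
      have h4 : HasFDerivAt (fun y => φ (m (p.1, y))) ((B (m (p.1, y))).comp L) y :=
        HasFDerivAt.comp y (hφ _ h1) h2
      have h5 := h4.sub (hφ y (Metric.ball_subset_ball (min_le_right _ _) hy))
      rw [h3, sub_self] at h5
      exact h5
    have hconst := (convex_ball (0 : E) (min δ r)).is_const_of_fderivWithin_eq_zero (𝕜 := ℝ)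
      (fun y hy => (hd y hy).differentiableAt.differentiableWithinAt)
      (fun y hy => (hd y hy).hasFDerivWithinAt.fderivWithin
        (Metric.isOpen_ball.uniqueDiffWithinAt hy)) hp'.2 (Metric.mem_ball_self (lt_min hδ hr))
    have hp0 := (hδb p (Metric.ball_subset_ball (min_le_left _ _) hp)).2
    simp only [hp0] at hconst
    have hφ0 : φ 0 = 0 := sub_self _
    rw [hφ0, sub_zero] at hconst
    exact sub_eq_iff_eq_add.1 hconst

end LocalLogarithm

/-! ### The exponential map of an abelian Lie group -/

section Exponential

open Filter Topology Manifold
open scoped ContDiff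

/-- A continuous homomorphism `p` to an abelian group, together with a local inverse `s`
near zero. -/
structure IsExponential {V A : Type*} [TopologicalSpace V] [AddCommGroup V] [TopologicalSpace A]
    [AddCommGroup A] (p : V →+ A) (s : A → V) : Prop where
  continuous : Continuous p
  continuousAt_section : ∀ᶠ a in 𝓝 (0 : A), ContinuousAt s a
  right_inv : ∀ᶠ a in 𝓝 (0 : A), p (s a) = a
  left_inv : ∀ᶠ v in 𝓝 (0 : V), s (p v) = v
  section_zero : s 0 = 0

section Extension

lemma exists_norm_lt_nat_mul {V : Type*} [NormedAddCommGroup V] {r : ℝ} (v : V) (hr : 0 < r) :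
    ∃ n : ℕ, n ≠ 0 ∧ ‖v‖ < n * r := by
  obtain ⟨n, hn⟩ := exists_nat_gt (‖v‖ / r)
  refine ⟨n, ?_, (div_lt_iff₀ hr).1 hn⟩
  rintro rfl
  have : 0 ≤ ‖v‖ / r := by positivity
  simp at hn
  linarith

variable {V A : Type*} [NormedAddCommGroup V] [NormedSpace ℝ V] [AddCommGroup A]

lemma norm_inv_nat_smul_lt {r : ℝ} {n : ℕ} {v : V} (hn : n ≠ 0) (hv : ‖v‖ < n * r) :
    ‖(n : ℝ)⁻¹ • v‖ < r := by
  have hn' : (0 : ℝ) < n := by positivity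
  rw [norm_smul, norm_inv, Real.norm_natCast, inv_mul_lt_iff₀ hn']
  exact hv

/-- A local homomorphism from a normed space to an abelian group extends to a homomorphism. -/
lemma exists_addMonoidHom_extending {ψ : V → A} {r : ℝ} (hr : 0 < r)
    (hψ : ∀ v w : V, ‖v‖ < r → ‖w‖ < r → ψ (v + w) = ψ v + ψ w) :
    ∃ p : V →+ A, (∀ v, ‖v‖ < r → p v = ψ v) ∧
      ∀ (n : ℕ) (v : V), n ≠ 0 → ‖v‖ < n * r → p v = n • ψ ((n : ℝ)⁻¹ • v) := by
  have h0 : ψ 0 = 0 := by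
    have := hψ 0 0 (by simpa) (by simpa)
    simpa using this
  have hmul : ∀ (k : ℕ) (w : V), k * ‖w‖ < r → ψ ((k : ℝ) • w) = k • ψ w := by
    intro k
    induction k with
    | zero => intro w _; simp [h0]
    | succ k ih =>
      intro w hw
      push_cast at hw ⊢
      have h1 : 0 ≤ (k : ℝ) * ‖w‖ := by positivity
      have h2 : (k : ℝ) * ‖w‖ < r := by nlinarith [norm_nonneg w]
      rw [add_smul, one_smul, hψ _ _ (by rw [norm_smul]; simpa using h2) (by nlinarith), ih w h2,
        succ_nsmul]
  -- Independence of `n`: the values for `n` and for `k` are both compared with the one for `k * n`.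
  have hindep : ∀ (n k : ℕ) (v : V), n ≠ 0 → k ≠ 0 → ‖v‖ < n * r →
      n • ψ ((n : ℝ)⁻¹ • v) = (k * n) • ψ (((k * n : ℕ) : ℝ)⁻¹ • v) := by
    intro n k v hn hk hv
    have hn' : (0 : ℝ) < n := by positivity
    have hk' : (0 : ℝ) < k := by positivity
    have h1 : (n : ℝ)⁻¹ • v = (k : ℝ) • (((k * n : ℕ) : ℝ)⁻¹ • v) := by
      rw [smul_smul]
      congr 1
      push_cast
      field_simp
    have h2 : (k : ℝ) * ‖((k * n : ℕ) : ℝ)⁻¹ • v‖ = ‖(n : ℝ)⁻¹ • v‖ := by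
      rw [h1, norm_smul (k : ℝ), Real.norm_natCast]
    rw [h1, hmul k _ (by rw [h2]; exact norm_inv_nat_smul_lt hn hv), ← mul_nsmul]
  have hwell : ∀ (n k : ℕ) (v : V), n ≠ 0 → k ≠ 0 → ‖v‖ < n * r → ‖v‖ < k * r →
      n • ψ ((n : ℝ)⁻¹ • v) = k • ψ ((k : ℝ)⁻¹ • v) := by
    intro n k v hn hk hv hv'
    rw [hindep n k v hn hk hv, hindep k n v hk hn hv', mul_comm]
  choose N hN0 hN1 using fun v : V => exists_norm_lt_nat_mul v hr
  have hval : ∀ (n : ℕ) (v : V), n ≠ 0 → ‖v‖ < n * r →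
      N v • ψ ((N v : ℝ)⁻¹ • v) = n • ψ ((n : ℝ)⁻¹ • v) :=
    fun n v hn hv => hwell _ _ _ (hN0 v) hn (hN1 v) hv
  -- The formula is retained for every admissible `n`, not only the chosen `N v`: one `n` then
  -- serves several vectors at once, and a whole neighbourhood when continuity is at stake.
  refine ⟨AddMonoidHom.mk' (fun v => N v • ψ ((N v : ℝ)⁻¹ • v)) ?_, ?_, hval⟩
  · intro v w
    have hle : ∀ {x : V} {n : ℕ}, N x ≤ n → ‖x‖ < n * r := fun {x n} h =>
      (hN1 x).trans_le (by gcongr)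
    let n := N v + N w + N (v + w)
    have hn : n ≠ 0 := by have := hN0 v; omega
    rw [hval n _ hn (hle (by omega)), hval n v hn (hle (by omega)), hval n w hn (hle (by omega)),
      smul_add, hψ _ _ (norm_inv_nat_smul_lt hn (hle (by omega)))
      (norm_inv_nat_smul_lt hn (hle (by omega))), smul_add]
  · intro v hv
    have := hval 1 v one_ne_zero (by simpa using hv)
    simpa using this

/-- A local isomorphism from a normed space to an abelian topological group extends to an
exponential. -/
lemma exists_isExponential_of_local [TopologicalSpace A] [IsTopologicalAddGroup A]
    {ψ : V → A} {s : A → V}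
    (hadd : ∀ᶠ x : V × V in 𝓝 (0, 0), ψ (x.1 + x.2) = ψ x.1 + ψ x.2)
    (hψ : ContinuousAt ψ 0) (hs : ∀ᶠ a in 𝓝 (0 : A), ContinuousAt s a) (hs0 : s 0 = 0)
    (hr : ∀ᶠ a in 𝓝 (0 : A), ψ (s a) = a) (hl : ∀ᶠ v in 𝓝 (0 : V), s (ψ v) = v) :
    ∃ p : V →+ A, IsExponential p s := by
  obtain ⟨r, hr0, hball⟩ := Metric.eventually_nhds_iff_ball.1 hadd
  obtain ⟨p, hp, -⟩ := exists_addMonoidHom_extending (ψ := ψ) hr0 fun v w hv hw => by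
    refine hball (v, w) ?_
    rw [← ball_prod_same]
    exact ⟨by simpa using hv, by simpa using hw⟩
  have hpψ : ∀ᶠ v in 𝓝 (0 : V), p v = ψ v := by
    filter_upwards [Metric.ball_mem_nhds (0 : V) hr0] with v hv
    exact hp v (by simpa using hv)
  have hsc : Tendsto s (𝓝 0) (𝓝 0) := by simpa [ContinuousAt, hs0] using hs.self_of_nhds
  have hright : ∀ᶠ a in 𝓝 (0 : A), p (s a) = a := by
    filter_upwards [hr, hsc.eventually hpψ] with a h1 h2
    rw [h2, h1]
  refine ⟨p, ?_, hs, hright, ?_, hs0⟩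
  -- A homomorphism is continuous as soon as it is so at zero, and near zero it is `ψ`.
  · exact continuous_of_continuousAt_zero p (hψ.congr (hpψ.mono fun v hv => hv.symm))
  · filter_upwards [hl, hpψ] with v h1 h2
    rw [h2, h1]

end Extension

/-- An abelian Lie group has an exponential from a finite-dimensional vector space. -/
theorem exists_isExponential_lieAddGroup {E M : Type*} [NormedAddCommGroup E] [NormedSpace ℝ E]
    [FiniteDimensional ℝ E] [TopologicalSpace M] (I : ModelWithCorners ℝ E M) [I.Boundaryless]
    (H : Type*) [AddCommGroup H] [TopologicalSpace H] [ChartedSpace M H]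
    [LieAddGroup I (⊤ : ℕ∞) H] : ∃ (p : E →+ H) (s : H → E), IsExponential p s := by
  have : IsTopologicalAddGroup H := topologicalAddGroup_of_lieAddGroup I (⊤ : ℕ∞)
  have := FiniteDimensional.complete ℝ E
  have : IsManifold I 1 H := IsManifold.of_le (n := ((⊤ : ℕ∞) : ℕ∞ω)) (by simp)
  let c := extChartAt I (0 : H)
  let e : H → E := fun h => c h - c 0
  let q : E → H := fun x => c.symm (x + c 0)
  have he0 : e 0 = 0 := sub_self _
  have hq0 : q 0 = 0 := by
    simp only [q, zero_add]
    exact extChartAt_to_inv (I := I) (0 : H)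
  have hqe : ∀ᶠ h in 𝓝 (0 : H), q (e h) = h := by
    filter_upwards [extChartAt_source_mem_nhds (I := I) (0 : H)] with h hh
    simp only [q, e, sub_add_cancel]
    exact c.left_inv hh
  have tc : Tendsto (fun x : E => x + c 0) (𝓝 0) (𝓝 (c 0)) := by
    have : Continuous fun x : E => x + c 0 := by fun_prop
    simpa using this.tendsto 0
  have heq : ∀ᶠ x in 𝓝 (0 : E), e (q x) = x := by
    filter_upwards [tc.eventually (extChartAt_target_mem_nhds (I := I) (0 : H))] with x hx
    simp only [q, e]
    rw [c.right_inv hx, add_sub_cancel_right]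
  have hec : ∀ᶠ h in 𝓝 (0 : H), ContinuousAt e h := by
    filter_upwards [extChartAt_source_mem_nhds (I := I) (0 : H)] with h hh
    exact (continuousAt_extChartAt' hh).sub continuousAt_const
  have hqs : ContMDiffAt 𝓘(ℝ, E) I (⊤ : ℕ∞) q 0 := by
    have h1 : ContMDiffAt 𝓘(ℝ, E) I (⊤ : ℕ∞) c.symm ((0 : E) + c 0) := by
      rw [zero_add]
      exact (contMDiffOn_extChartAt_symm (0 : H)).contMDiffAt (extChartAt_target_mem_nhds (0 : H))
    exact ContMDiffAt.comp (0 : E) h1 (contDiff_id.add contDiff_const).contMDiff.contMDiffAt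
  have hes : ContMDiffAt I 𝓘(ℝ, E) (⊤ : ℕ∞) e 0 := by
    have h1 : ContMDiffAt I 𝓘(ℝ, E) (⊤ : ℕ∞) c 0 := contMDiffAt_extChartAt
    exact h1.sub contMDiffAt_const
  have hqc : Tendsto q (𝓝 0) (𝓝 0) := by simpa [ContinuousAt, hq0] using hqs.continuousAt
  have hec0 : Tendsto e (𝓝 0) (𝓝 0) := by simpa [ContinuousAt, he0] using hes.continuousAt
  -- The group law of `H` read in a chart translated so that the identity element is the origin.
  let m : E × E → E := fun x => e (q x.1 + q x.2)
  have hm : ContDiffAt ℝ (⊤ : ℕ∞) m (0, 0) := by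
    rw [← contMDiffAt_iff_contDiffAt]
    have h1 : ContMDiffAt 𝓘(ℝ, E × E) I (⊤ : ℕ∞) (fun x : E × E => q x.1 + q x.2) (0, 0) :=
      (ContMDiffAt.comp ((0, 0) : E × E) (g := q) hqs contDiff_fst.contMDiff.contMDiffAt).add
        (ContMDiffAt.comp ((0, 0) : E × E) (g := q) hqs contDiff_snd.contMDiff.contMDiffAt)
    refine ContMDiffAt.comp ((0, 0) : E × E) (g := e) ?_ h1
    simpa [hq0] using hes
  have tadd : Tendsto (fun x : H × H => x.1 + x.2) (𝓝 (0, 0)) (𝓝 0) := by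
    simpa using (continuous_add (M := H)).tendsto (0, 0)
  have tqq : Tendsto (fun x : E × E => q x.1 + q x.2) (𝓝 (0, 0)) (𝓝 0) := by
    refine tadd.comp (Tendsto.prodMk_nhds ?_ ?_)
    · exact hqc.comp (continuous_fst.tendsto ((0, 0) : E × E))
    · exact hqc.comp (continuous_snd.tendsto ((0, 0) : E × E))
  have hqm : ∀ᶠ x : E × E in 𝓝 (0, 0), q (m x) = q x.1 + q x.2 := tqq.eventually hqe
  obtain ⟨φ, hφ0, hφd, hφm⟩ := exists_local_logarithm (m := m)
    (hm.of_le (WithTop.coe_le_coe.2 (le_top (a := (3 : ℕ∞)))))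
    (heq.mono fun x hx => by simp only [m, hq0, add_zero, hx])
    (Eventually.of_forall fun x => by simp only [m, Prod.fst_swap, Prod.snd_swap, add_comm])
    (by
      have t1 : Tendsto (fun p : E × E × E => (p.1, p.2.1)) (𝓝 (0, 0, 0)) (𝓝 (0, 0)) :=
        Continuous.tendsto (by fun_prop) (0, 0, 0)
      have t2 : Tendsto (fun p : E × E × E => p.2) (𝓝 (0, 0, 0)) (𝓝 (0, 0)) :=
        Continuous.tendsto (by fun_prop) (0, 0, 0)
      filter_upwards [t1.eventually hqm, t2.eventually hqm] with p h1 h2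
      change e (q (m (p.1, p.2.1)) + q p.2.2) = e (q p.1 + q (m p.2))
      rw [h1, h2, add_assoc])
  have hφd' : HasStrictFDerivAt φ ((ContinuousLinearEquiv.refl ℝ E : E ≃L[ℝ] E) : E →L[ℝ] E) 0 :=
    hφd
  -- The derivative of `φ` at `0` is the identity, so the inverse function theorem makes `φ` a local
  -- homeomorphism.
  let P := hφd'.toOpenPartialHomeomorph φ
  have h0P : (0 : E) ∈ P.source := hφd'.mem_toOpenPartialHomeomorph_source
  have hPφ : ∀ x, P x = φ x := fun x => rfl
  have h0t : (0 : E) ∈ P.target := by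
    have := P.map_source h0P
    rwa [hPφ, hφ0] at this
  have hPs0 : P.symm 0 = 0 := by
    have := P.left_inv h0P
    rwa [hPφ, hφ0] at this
  let ψ : E → H := fun v => q (P.symm v)
  let s : H → E := fun h => φ (e h)
  have hPc : Tendsto P.symm (𝓝 0) (𝓝 0) := by
    have := (P.continuousAt_symm h0t).tendsto
    rwa [hPs0] at this
  have hψc : Tendsto ψ (𝓝 0) (𝓝 0) := hqc.comp hPc
  have hs0 : s 0 = 0 := by simp only [s, he0, hφ0]
  have hψ0 : ψ 0 = 0 := by simp only [ψ, hPs0, hq0]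
  have hφc : ∀ᶠ x in 𝓝 (0 : E), ContinuousAt φ x := by
    filter_upwards [P.open_source.mem_nhds h0P] with x hx using P.continuousAt hx
  have hsc : ∀ᶠ h in 𝓝 (0 : H), ContinuousAt s h := by
    filter_upwards [hec, hec0.eventually hφc] with h h1 h2
    exact ContinuousAt.comp h2 h1
  have hψs : ∀ᶠ h in 𝓝 (0 : H), ψ (s h) = h := by
    filter_upwards [hqe, hec0.eventually (P.open_source.mem_nhds h0P)] with h h1 h2
    change q (P.symm (P (e h))) = h
    rw [P.left_inv h2, h1]
  have hsψ : ∀ᶠ v in 𝓝 (0 : E), s (ψ v) = v := by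
    filter_upwards [P.open_target.mem_nhds h0t, hPc.eventually heq] with v h1 h2
    change φ (e (q (P.symm v))) = v
    rw [h2, ← hPφ, P.right_inv h1]
  have hsadd : ∀ᶠ x : H × H in 𝓝 (0, 0), s (x.1 + x.2) = s x.1 + s x.2 := by
    have tee : Tendsto (fun x : H × H => (e x.1, e x.2)) (𝓝 (0, 0)) (𝓝 (0, 0)) :=
      (hec0.comp (continuous_fst.tendsto ((0, 0) : H × H))).prodMk_nhds
        (hec0.comp (continuous_snd.tendsto ((0, 0) : H × H)))
    filter_upwards [tee.eventually hφm,
      (continuous_fst.tendsto ((0, 0) : H × H)).eventually hqe,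
      (continuous_snd.tendsto ((0, 0) : H × H)).eventually hqe] with x h1 h2 h3
    rw [← h1]
    change _ = φ (e (q (e x.1) + q (e x.2)))
    rw [h2, h3]
  refine (exists_isExponential_of_local (ψ := ψ) (s := s) ?_ ?_ hsc hs0 hψs hsψ).imp
    fun p hp => ⟨s, hp⟩
  · have tψ : Tendsto (fun x : E × E => (ψ x.1, ψ x.2)) (𝓝 (0, 0)) (𝓝 (0, 0)) :=
      (hψc.comp (continuous_fst.tendsto ((0, 0) : E × E))).prodMk_nhds
        (hψc.comp (continuous_snd.tendsto ((0, 0) : E × E)))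
    filter_upwards [tψ.eventually hsadd, (tadd.comp tψ).eventually hψs,
      (continuous_fst.tendsto ((0, 0) : E × E)).eventually hsψ,
      (continuous_snd.tendsto ((0, 0) : E × E)).eventually hsψ] with x h1 h2 h3 h4
    simp only [Function.comp] at h2
    -- Additivity passes from the logarithm `s` to its local inverse: `v + w = s (ψ v + ψ w)`, to
    -- which `ψ` is applied.
    rw [← h2, h1, h3, h4]
  · simpa [ContinuousAt, hψ0] using hψc

end Exponential

/-! ### Lifting functions and actions through an exponential -/

section LiftingThroughExponential

open Filter Topology

namespace IsExponential

section

variable {V A : Type*} [TopologicalSpace V] [AddCommGroup V] [TopologicalSpace A]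
  [AddCommGroup A] {p : V →+ A} {s : A → V}

/-- The points near which `s` is a continuous section. -/
lemma eventually_good (hp : IsExponential p s) :
    ∀ᶠ a in 𝓝 (0 : A), ContinuousAt s a ∧ p (s a) = a :=
  hp.continuousAt_section.and hp.right_inv

lemma tendsto_section (hp : IsExponential p s) : Tendsto s (𝓝 0) (𝓝 0) := by
  simpa [ContinuousAt, hp.section_zero] using hp.continuousAt_section.self_of_nhds

end

variable {V A : Type*} [NormedAddCommGroup V] [AddCommGroup A] [TopologicalSpace A] {p : V →+ A}
  {s : A → V}

/-- Both sides have the same image under `p` and are close to zero, where `s` inverts `p`. -/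
lemma eventually_section_add (hp : IsExponential p s) :
    ∀ᶠ x : A × A in 𝓝 (0, 0), s (x.1 + x.2) = s x.1 + s x.2 := by
  have t1 := continuous_fst.tendsto ((0, 0) : A × A)
  have t2 := continuous_snd.tendsto ((0, 0) : A × A)
  have t3 : Tendsto (fun x : A × A => s x.1 + s x.2) (𝓝 (0, 0)) (𝓝 0) := by
    simpa using (hp.tendsto_section.comp t1).add (hp.tendsto_section.comp t2)
  filter_upwards [t1.eventually hp.right_inv, t2.eventually hp.right_inv,
    t3.eventually hp.left_inv] with x h1 h2 h3
  rw [← h3, map_add, h1, h2]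

/-- The kernel of `p` is discrete, because `s` is a left inverse of `p` near zero. -/
lemma isLocallyConstant_of_map_eq_zero (hp : IsExponential p s) {X : Type*} [TopologicalSpace X]
    {f : X → V} (hf : Continuous f) (h : ∀ x, p (f x) = 0) : IsLocallyConstant f := by
  rw [IsLocallyConstant.iff_eventually_eq]
  intro x
  have t : Tendsto (fun y => f y - f x) (𝓝 x) (𝓝 0) := by
    have hc : Continuous fun y => f y - f x := by fun_prop
    simpa using hc.tendsto x
  filter_upwards [t.eventually hp.left_inv] with y hy
  rw [map_sub, h, h, sub_zero, hp.section_zero] at hy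
  exact (sub_eq_zero.1 hy.symm)

/-- A continuous map from a connected space to the kernel of an exponential is constant. -/
lemma eq_of_map_eq_zero (hp : IsExponential p s) {X : Type*} [TopologicalSpace X]
    [PreconnectedSpace X] {f : X → V} (hf : Continuous f) (h : ∀ x, p (f x) = 0) (x y : X) :
    f x = f y :=
  (hp.isLocallyConstant_of_map_eq_zero hf h).apply_eq_of_isPreconnected
    PreconnectedSpace.isPreconnected_univ (Set.mem_univ _) (Set.mem_univ _)

/-- Lifts through an exponential are unique. -/
lemma lift_unique (hp : IsExponential p s) {X : Type*} [TopologicalSpace X]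
    [PreconnectedSpace X] {f g : X → V} (hf : Continuous f) (hg : Continuous g)
    (h : ∀ x, p (f x) = p (g x)) {x₀ : X} (h₀ : f x₀ = g x₀) (x : X) : f x = g x := by
  have := hp.eq_of_map_eq_zero (hf.sub hg) (fun x => by simp [h]) x x₀
  rw [Pi.sub_apply, Pi.sub_apply, h₀, sub_self] at this
  exact sub_eq_zero.1 this

/-- A continuous function on a product of connected spaces, one of them compact, which vanishes on
both axes lifts through an exponential. -/
theorem exists_lift_of_eq_zero_on_axes [IsTopologicalAddGroup A] (hp : IsExponential p s)
    {X Y : Type*} [TopologicalSpace X]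
    [CompactSpace X] [PreconnectedSpace X] [TopologicalSpace Y] [PreconnectedSpace Y]
    {f : X × Y → A} (hf : Continuous f) {x₀ : X} {y₀ : Y} (hx : ∀ y, f (x₀, y) = 0)
    (hy : ∀ x, f (x, y₀) = 0) :
    ∃ F : X × Y → V, Continuous F ∧ ∀ z, p (F z) = f z := by
  -- The slices of `f` over points of `Y` that lift, normalised to vanish at `x₀`. By connectedness
  -- of `X` such a lift is unique, so the slices will fit together.
  let S : Set Y := {y | ∃ F : X → V, Continuous F ∧ F x₀ = 0 ∧ ∀ x, p (F x) = f (x, y)}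
  have hgood : ∀ y₁, ∀ᶠ y in 𝓝 y₁, ∀ x, ContinuousAt s (f (x, y) - f (x, y₁)) ∧
      p (s (f (x, y) - f (x, y₁))) = f (x, y) - f (x, y₁) := by
    intro y₁
    have := isCompact_univ (X := X) |>.eventually_forall_of_forall_eventually (x₀ := y₁)
      (P := fun y x => ContinuousAt s (f (x, y) - f (x, y₁)) ∧
        p (s (f (x, y) - f (x, y₁))) = f (x, y) - f (x, y₁)) (fun x _ => by
        have t : Tendsto (fun z : Y × X => f (z.2, z.1) - f (z.2, y₁)) (𝓝 (y₁, x)) (𝓝 0) := by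
          have hc : Continuous fun z : Y × X => f (z.2, z.1) - f (z.2, y₁) := by fun_prop
          simpa using hc.tendsto (y₁, x)
        exact t.eventually hp.eventually_good)
    exact this.mono fun y h x => h x (Set.mem_univ x)
  have hcont : ∀ {y₁ y}, (∀ x, ContinuousAt s (f (x, y) - f (x, y₁)) ∧
      p (s (f (x, y) - f (x, y₁))) = f (x, y) - f (x, y₁)) →
      Continuous fun x => s (f (x, y) - f (x, y₁)) := fun {y₁ y} h =>
    continuous_iff_continuousAt.2 fun x => ContinuousAt.comp (g := s)
      (f := fun x => f (x, y) - f (x, y₁)) (h x).1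
      (Continuous.continuousAt (by fun_prop))
  -- By compactness of `X`, nearby slices differ by a function with uniformly small values, which
  -- `s` lifts. Hence membership in `S` is locally constant on `Y`, and `S` is clopen; it contains
  -- `y₀`, where the slice is zero.
  have hS : ∀ y₁, ∀ᶠ y in 𝓝 y₁, (y ∈ S ↔ y₁ ∈ S) := by
    intro y₁
    filter_upwards [hgood y₁] with y h
    constructor
    · rintro ⟨F, hF, hF0, hFp⟩
      refine ⟨fun x => F x - s (f (x, y) - f (x, y₁)), hF.sub (hcont h), ?_, fun x => ?_⟩
      · simp [hF0, hx, hp.section_zero]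
      · rw [map_sub, (h x).2, hFp, sub_sub_cancel]
    · rintro ⟨F, hF, hF0, hFp⟩
      refine ⟨fun x => F x + s (f (x, y) - f (x, y₁)), hF.add (hcont h), ?_, fun x => ?_⟩
      · simp [hF0, hx, hp.section_zero]
      · rw [map_add, (h x).2, hFp, add_sub_cancel]
  have hSuniv : S = Set.univ := by
    refine IsClopen.eq_univ ⟨⟨?_⟩, ?_⟩ ⟨y₀, fun _ => 0, continuous_const, rfl, fun x => ?_⟩
    · rw [isOpen_iff_eventually]
      exact fun y₁ h₁ => (hS y₁).mono fun y hy h => h₁ (hy.1 h)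
    · rw [isOpen_iff_eventually]
      exact fun y₁ h₁ => (hS y₁).mono fun y hy => hy.2 h₁
    · rw [hy, map_zero]
  have hall : ∀ y, y ∈ S := fun y => hSuniv ▸ Set.mem_univ y
  choose F hF hF0 hFp using hall
  refine ⟨fun z => F z.2 z.1, ?_, fun z => hFp z.2 z.1⟩
  rw [continuous_iff_continuousAt]
  rintro ⟨x₁, y₁⟩
  -- Near `y₁`, uniqueness forces the lifted slice to be the one at `y₁` plus the small correction
  -- given by `s`; this formula is visibly continuous in both variables.
  have heq : ∀ᶠ z : X × Y in 𝓝 (x₁, y₁), F y₁ z.1 + s (f z - f (z.1, y₁)) = F z.2 z.1 := by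
    filter_upwards [(continuous_snd.tendsto (x₁, y₁)).eventually (hgood y₁)] with z h
    refine hp.lift_unique (f := fun x => F y₁ x + s (f (x, z.2) - f (x, y₁)))
      ((hF y₁).add (hcont h)) (hF z.2) (fun x => ?_) (x₀ := x₀) ?_ z.1
    · rw [map_add, (h x).2, hFp, hFp, add_sub_cancel]
    · simp [hF0, hx, hp.section_zero]
  refine ContinuousAt.congr ?_ heq
  refine ((hF y₁).continuousAt.comp continuousAt_fst).add ?_
  refine ContinuousAt.comp (g := s) (f := fun z : X × Y => f z - f (z.1, y₁)) ?_
    (Continuous.continuousAt (by fun_prop))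
  rw [sub_self]
  exact hp.continuousAt_section.self_of_nhds

/-- A continuous action of a compact group lifts through an exponential to a continuous linear
action. -/
theorem exists_lift_smul [NormedSpace ℝ V] (hp : IsExponential p s) {G : Type*} [Group G]
    [TopologicalSpace G] [CompactSpace G] [DistribMulAction G A] [ContinuousSMul G A] :
    ∃ T : G → V →L[ℝ] V, (Continuous fun x : G × V => T x.1 x.2) ∧
      ∀ g v, p (T g v) = g • p v := by
  have t0 : ∀ g : G, Tendsto (fun z : V × G => z.2 • p z.1) (𝓝 (0, g)) (𝓝 0) := by
    intro g
    have hc : Continuous fun z : V × G => z.2 • p z.1 :=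
      continuous_snd.smul (hp.continuous.comp continuous_fst)
    simpa using hc.tendsto (0, g)
  -- Compactness of `G` gives one radius, valid for all `g`, on which `v ↦ s (g • p v)` is defined
  -- through the good part of `s` and is a local homomorphism.
  have h1 : ∀ᶠ v in 𝓝 (0 : V), ∀ g ∈ (Set.univ : Set G),
      ContinuousAt s (g • p v) ∧ p (s (g • p v)) = g • p v :=
    isCompact_univ.eventually_forall_of_forall_eventually fun g _ =>
      (t0 g).eventually hp.eventually_good
  have h2 : ∀ᶠ x in 𝓝 ((0, 0) : V × V), ∀ g ∈ (Set.univ : Set G),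
      s (g • p x.1 + g • p x.2) = s (g • p x.1) + s (g • p x.2) := by
    refine isCompact_univ.eventually_forall_of_forall_eventually fun g _ => ?_
    have c1 : Continuous fun z : (V × V) × G => (z.1.1, z.2) := by fun_prop
    have c2 : Continuous fun z : (V × V) × G => (z.1.2, z.2) := by fun_prop
    have t1 := (t0 g).comp (c1.tendsto ((0, 0), g))
    have t2 := (t0 g).comp (c2.tendsto ((0, 0), g))
    exact (t1.prodMk_nhds t2).eventually hp.eventually_section_add
  obtain ⟨r₁, hr₁, hb₁⟩ := Metric.eventually_nhds_iff_ball.1 h1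
  obtain ⟨r₂, hr₂, hb₂⟩ := Metric.eventually_nhds_iff_ball.1 h2
  let r := min r₁ r₂
  have hr : 0 < r := lt_min hr₁ hr₂
  have hext := fun g : G => exists_addMonoidHom_extending (ψ := fun v => s (g • p v)) hr
    fun v w hv hw => by
      have := hb₂ (v, w) (by
        rw [← ball_prod_same]
        exact ⟨by simpa using hv.trans_le (min_le_right _ _),
          by simpa using hw.trans_le (min_le_right _ _)⟩) g (Set.mem_univ g)
      simpa using this
  choose T hT hTn using hext
  have hgood : ∀ (g : G) (v : V), ‖v‖ < r →
      ContinuousAt s (g • p v) ∧ p (s (g • p v)) = g • p v := fun g v hv =>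
    hb₁ v (by simpa using hv.trans_le (min_le_left _ _)) g (Set.mem_univ g)
  have hcont : Continuous fun x : G × V => T x.1 x.2 := by
    rw [continuous_iff_continuousAt]
    rintro ⟨g₀, v₀⟩
    obtain ⟨n, hn, hv₀⟩ := exists_norm_lt_nat_mul v₀ hr
    -- A fixed `n` works for all vectors near `v₀`, so joint continuity can be read off from the
    -- local formula.
    have hev : ∀ᶠ x : G × V in 𝓝 (g₀, v₀),
        n • s (x.1 • p ((n : ℝ)⁻¹ • x.2)) = T x.1 x.2 := by
      have hc : Continuous fun x : G × V => ‖x.2‖ := by fun_prop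
      filter_upwards [hc.continuousAt.eventually (gt_mem_nhds hv₀)] with x hx
      exact (hTn x.1 n x.2 hn hx).symm
    refine ContinuousAt.congr ?_ hev
    refine ContinuousAt.const_smul ?_ n
    refine ContinuousAt.comp (g := s) (f := fun x : G × V => x.1 • p ((n : ℝ)⁻¹ • x.2))
      (hgood _ _ (norm_inv_nat_smul_lt hn hv₀)).1 (Continuous.continuousAt ?_)
    exact continuous_fst.smul (hp.continuous.comp (continuous_snd.const_smul _))
  -- A continuous additive map between real vector spaces is linear.
  refine ⟨fun g => (T g).toRealLinearMap (hcont.comp (Continuous.prodMk_right g)), hcont, ?_⟩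
  intro g v
  obtain ⟨n, hn, hv⟩ := exists_norm_lt_nat_mul v hr
  change p (T g v) = g • p v
  have hn' : (n : ℝ) ≠ 0 := by exact_mod_cast hn
  rw [hTn g n v hn hv, map_nsmul, (hgood g _ (norm_inv_nat_smul_lt hn hv)).2,
    smul_comm n g, ← map_nsmul,
    ← Nat.cast_smul_eq_nsmul ℝ, smul_smul, mul_inv_cancel₀ hn', one_smul]

end IsExponential

end LiftingThroughExponential

/-! ### Averaging cocycles over Haar measure -/

section Averaging

open Filter Topology MeasureTheory

variable {V : Type*} [NormedAddCommGroup V] [NormedSpace ℝ V]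

/-- Since `G` is compact, `f (x, ·)` tends to `f (x₀, ·)` uniformly, and the total mass is one. -/
lemma continuous_integral_of_compact {X G : Type*} [TopologicalSpace X] [TopologicalSpace G]
    [CompactSpace G] [MeasurableSpace G] [BorelSpace G] [SecondCountableTopology V]
    (μ : Measure G) [IsProbabilityMeasure μ] {f : X × G → V} (hf : Continuous f) :
    Continuous fun x => ∫ g, f (x, g) ∂μ := by
  have hint : ∀ x, Integrable (fun g => f (x, g)) μ := fun x =>
    Continuous.integrable_of_hasCompactSupport (by fun_prop) (HasCompactSupport.of_compactSpace _)
  rw [Metric.continuous_iff']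
  intro x₀ ε hε
  have h := isCompact_univ (X := G) |>.eventually_forall_of_forall_eventually (x₀ := x₀)
    (P := fun x g => ‖f (x, g) - f (x₀, g)‖ < ε / 2) (fun g _ => by
      have hc : Continuous fun z : X × G => ‖f z - f (x₀, z.2)‖ := by fun_prop
      have ht := hc.tendsto (x₀, g)
      simp only [sub_self, norm_zero] at ht
      exact ht.eventually (gt_mem_nhds (half_pos hε)))
  filter_upwards [h] with x hx
  rw [dist_eq_norm, ← integral_sub (hint x) (hint x₀)]
  refine (norm_integral_le_of_norm_le_const (C := ε / 2)
    (Eventually.of_forall fun g => (hx g (Set.mem_univ g)).le)).trans_lt ?_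
  simp [hε]

/-- Averaging over a compact group shows that linear continuous 3-cocycles are coboundaries. -/
theorem exists_primitive_of_linear_cocycle [FiniteDimensional ℝ V] {G : Type*} [Group G]
    [TopologicalSpace G] [IsTopologicalGroup G] [CompactSpace G] (T : G → V →L[ℝ] V)
    {a : G × G × G → V} (ha : Continuous a)
    (hcocycle : ∀ x y z w, T x (a (y, z, w)) - a (x * y, z, w) + a (x, y * z, w) -
      a (x, y, z * w) + a (x, y, z) = 0) :
    ∃ b : G × G → V, Continuous b ∧ ∀ x y z,
      a (x, y, z) = T x (b (y, z)) - b (x * y, z) + b (x, y * z) - b (x, y) := by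
  let _ : MeasurableSpace G := borel G
  have : BorelSpace G := ⟨rfl⟩
  have : CompleteSpace V := FiniteDimensional.complete ℝ V
  have : ProperSpace V := FiniteDimensional.proper_real V
  let μ : Measure G := Measure.haarMeasure ⊤
  have : IsProbabilityMeasure μ := ⟨by
    have := Measure.haarMeasure_self (K₀ := (⊤ : TopologicalSpace.PositiveCompacts G))
    simpa using this⟩
  have hint : ∀ f : G → V, Continuous f → Integrable f μ := fun f hf =>
    hf.integrable_of_hasCompactSupport (HasCompactSupport.of_compactSpace _)
  -- Integrate the cocycle identity over `w`: left invariance turns `a (x, y, z * w)` into `a (x, y,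
  -- w)`, the term `a (x, y, z)` is unchanged, and the other four are the differential of the
  -- integral. Only linearity of each `T x` enters.
  refine ⟨fun q => -∫ g, a (q.1, q.2, g) ∂μ, ?_, ?_⟩
  · exact (continuous_integral_of_compact μ (f := fun z : (G × G) × G => a (z.1.1, z.1.2, z.2))
      (by fun_prop)).neg
  · intro x y z
    have i1 : Integrable (fun w => T x (a (y, z, w))) μ := hint _ (by fun_prop)
    have i2 : Integrable (fun w => a (x * y, z, w)) μ := hint _ (by fun_prop)
    have i3 : Integrable (fun w => a (x, y * z, w)) μ := hint _ (by fun_prop)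
    have i4 : Integrable (fun w => a (x, y, z * w)) μ := hint _ (by fun_prop)
    have i5 : Integrable (fun _ : G => a (x, y, z)) μ := hint _ (by fun_prop)
    have i12 : Integrable (fun w => T x (a (y, z, w)) - a (x * y, z, w)) μ := i1.sub i2
    have i123 : Integrable (fun w => T x (a (y, z, w)) - a (x * y, z, w) + a (x, y * z, w)) μ :=
      i12.add i3
    have i1234 : Integrable (fun w => T x (a (y, z, w)) - a (x * y, z, w) + a (x, y * z, w) -
      a (x, y, z * w)) μ := i123.sub i4
    have e : ∫ w, (T x (a (y, z, w)) - a (x * y, z, w) + a (x, y * z, w) -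
        a (x, y, z * w) + a (x, y, z)) ∂μ = 0 := by
      simp only [hcocycle, integral_zero]
    rw [integral_add i1234 i5, integral_sub i123 i4, integral_add i12 i3, integral_sub i1 i2,
      (T x).integral_comp_comm (hint _ (by fun_prop)),
      integral_mul_left_eq_self (fun w => a (x, y, w)) z, integral_const] at e
    simp only [probReal_univ, one_smul] at e
    simp only [map_neg]
    rw [eq_neg_of_add_eq_zero_right e]
    abel

end Averaging

/-! ### Vanishing of continuous 3-cocycles -/

section ThirdCohomology

variable {V A : Type*} [NormedAddCommGroup V] [NormedSpace ℝ V] [FiniteDimensional ℝ V]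
  [AddCommGroup A] [TopologicalSpace A] [IsTopologicalAddGroup A] {p : V →+ A} {s : A → V}

/-- Continuous 3-cocycles of a connected compact group with values in a group with an exponential
are coboundaries. -/
theorem IsExponential.exists_primitive (hp : IsExponential p s) {G : Type*} [Group G]
    [TopologicalSpace G] [IsTopologicalGroup G] [CompactSpace G] [PreconnectedSpace G]
    [DistribMulAction G A] [ContinuousSMul G A] {a : G × G × G → A} (ha : Continuous a)
    (hcocycle : ∀ x y z w, x • a (y, z, w) - a (x * y, z, w) + a (x, y * z, w) -
      a (x, y, z * w) + a (x, y, z) = 0) :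
    ∃ b : G × G → A, Continuous b ∧ ∀ x y z,
      a (x, y, z) = x • b (y, z) - b (x * y, z) + b (x, y * z) - b (x, y) := by
  obtain ⟨T, hTc, hTp⟩ := hp.exists_lift_smul (G := G)
  -- normalisation of `a`, and a first correction killing it on the axes
  have h010 : ∀ y, a (1, y, 1) = 0 := fun y => by
    have := hcocycle 1 y 1 1
    simpa using this
  -- The coboundary of `c` is `a (x, 1, 1)` at `(x, 1, 1)`, `a (1, 1, z)` at `(1, 1, z)`, and zero
  -- at `(1, y, 1)`, where `a` already vanishes.
  let c : G × G → A := fun q => a (1, 1, q.2) - a (q.1, 1, 1)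
  have hc : Continuous c := by fun_prop
  let d : G × G × G → A := fun t => a t -
    (t.1 • c (t.2.1, t.2.2) - c (t.1 * t.2.1, t.2.2) + c (t.1, t.2.1 * t.2.2) - c (t.1, t.2.1))
  have hd : Continuous d := by fun_prop
  have hdx : ∀ x, d (x, 1, 1) = 0 := fun x => by simp [d, c, h010]
  have hdy : ∀ y, d (1, y, 1) = 0 := fun y => by simp [d, c, h010]
  have hdz : ∀ z, d (1, 1, z) = 0 := fun z => by simp [d, c, h010]
  have hdcocycle : ∀ x y z w, x • d (y, z, w) - d (x * y, z, w) + d (x, y * z, w) -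
      d (x, y, z * w) + d (x, y, z) = 0 := by
    intro x y z w
    have h := hcocycle x y z w
    simp only [d, smul_sub, smul_add, smul_smul, mul_assoc]
    rw [← h]
    abel
  -- lifting to the vector space
  obtain ⟨F₁, hF₁, hF₁p⟩ := hp.exists_lift_of_eq_zero_on_axes (X := G) (Y := G × G)
    (f := fun t => d t - d (1, t.2)) (by fun_prop) (x₀ := 1) (y₀ := (1, 1))
    (fun y => sub_self _) (fun x => by rw [hdx, hdx, sub_zero])
  -- The lifting lemma handles two factors at a time. Subtracting `d (1, y, z)` from `d` gave a
  -- function vanishing on both axes of `G × (G × G)`; the subtracted part vanishes on both axes of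
  -- `G × G`.
  obtain ⟨F₂, hF₂, hF₂p⟩ := hp.exists_lift_of_eq_zero_on_axes (X := G) (Y := G)
    (f := fun t => d (1, t)) (by fun_prop) (x₀ := 1) (y₀ := 1) hdz hdy
  let F : G × G × G → V := fun t => F₁ t + F₂ t.2
  have hF : Continuous F := by fun_prop
  have hFp : ∀ t, p (F t) = d t := fun t => by
    simp only [F, map_add, hF₁p, hF₂p, sub_add_cancel]
  -- the differential of the lift is constant
  let D : G × G × G × G → V := fun t => T t.1 (F t.2) - F (t.1 * t.2.1, t.2.2.1, t.2.2.2) +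
    F (t.1, t.2.1 * t.2.2.1, t.2.2.2) - F (t.1, t.2.1, t.2.2.1 * t.2.2.2) +
    F (t.1, t.2.1, t.2.2.1)
  have hD : Continuous D := by
    have h1 : Continuous fun t : G × G × G × G => T t.1 (F t.2) :=
      hTc.comp (continuous_fst.prodMk (hF.comp continuous_snd))
    fun_prop
  have hDp : ∀ t, p (D t) = 0 := by
    rintro ⟨x, y, z, w⟩
    simp only [D, map_add, map_sub, hTp, hFp]
    exact hdcocycle x y z w
  have hDconst : ∀ t, D t = D 1 := fun t => hp.eq_of_map_eq_zero hD hDp t 1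
  have hT1 : ∀ v, T 1 v = v := fun v =>
    hp.lift_unique (f := fun v => T 1 v) (g := fun v => v) (by fun_prop) continuous_id
      (fun v => by rw [hTp, one_smul]) (x₀ := 0) (by simp) v
  -- As `x` varies, `T x (D 1)` stays in the kernel of `p`, so it keeps its value at `x = 1`.
  have hTD : ∀ x, T x (D 1) = D 1 := fun x =>
    hp.lift_unique (f := fun x => T x (D 1)) (g := fun _ => D 1)
      (hTc.comp (continuous_id.prodMk continuous_const)) continuous_const
      (fun x => by rw [hTp, hDp, smul_zero]) (x₀ := 1) (hT1 _) x
  -- The differential of an invariant constant 3-cochain is that constant, since its five terms have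
  -- alternating signs. Subtracting `D 1` therefore makes `F` a cocycle, still lifting `d` because
  -- `p (D 1) = 0`.
  obtain ⟨b, hb, hbF⟩ := exists_primitive_of_linear_cocycle T (a := fun t => F t - D 1)
    (by fun_prop) (fun x y z w => by
      have h : T x (F (y, z, w)) - F (x * y, z, w) + F (x, y * z, w) - F (x, y, z * w) +
        F (x, y, z) = D 1 := hDconst (x, y, z, w)
      rw [map_sub, hTD, ← sub_eq_zero.2 h]
      abel)
  refine ⟨fun q => p (b q) + c q, (hp.continuous.comp hb).add hc, fun x y z => ?_⟩
  have h := congrArg p (hbF x y z)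
  simp only [map_sub, map_add, hTp, hFp, hDp, sub_zero] at h
  have h2 : a (x, y, z) = d (x, y, z) +
      (x • c (y, z) - c (x * y, z) + c (x, y * z) - c (x, y)) := by
    simp only [d, sub_add_cancel]
  rw [h2, h]
  simp only [smul_add]
  abel

end ThirdCohomology

/-! ### The associator as a coboundary, and computing morphisms in `UnitEnd` -/

namespace SpecialTopologicalTwoGroup

section AssociatorPrimitive

variable {C : SpecialTopologicalTwoGroup.{u}}

lemma contCochainD_two_apply (β : C(Fin 2 → C.cat.Obj, C.UnitEnd)) (g : Fin 3 → C.cat.Obj) :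
    contCochainD C.cat.Obj C.UnitEnd 2 β g =
      g 0 • β ![g 1, g 2] - β ![g 0 * g 1, g 2] + β ![g 0, g 1 * g 2] - β ![g 0, g 1] := by
  have e0 : (fun i : Fin 2 => g i.succ) = ![g 1, g 2] := by
    ext i; fin_cases i <;> rfl
  have e1 : Fin.contractNth 0 (· * ·) g = ![g 0 * g 1, g 2] := by
    ext i; fin_cases i <;> rfl
  have e2 : Fin.contractNth 1 (· * ·) g = ![g 0, g 1 * g 2] := by
    ext i; fin_cases i <;> rfl
  have e3 : Fin.contractNth 2 (· * ·) g = ![g 0, g 1] := by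
    ext i; fin_cases i <;> rfl
  change g 0 • β (fun i => g i.succ) + ∑ j : Fin 3, _ = _
  rw [Fin.sum_univ_three, e0, e1, e2, e3]
  norm_num
  abel

/-- The pentagon identity, in terms of the associator as a cochain. -/
lemma toUnitEnd_associator_cocycle (w x y z : C.cat.Obj) :
    w • toUnitEnd (mor (α_ x y z).hom) - toUnitEnd (mor (α_ (w * x) y z).hom) +
      toUnitEnd (mor (α_ w (x * y) z).hom) - toUnitEnd (mor (α_ w x (y * z)).hom) +
      toUnitEnd (mor (α_ w x y).hom) = 0 := by
  have h := DFunLike.congr_fun ((AddMonoidHom.mem_ker).1 C.associatorCochain_mem) ![w, x, y, z]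
  change w • toUnitEnd (mor (α_ x y z).hom) + ∑ j : Fin 4, _ = 0 at h
  rw [Fin.sum_univ_four] at h
  change _ + (_ • toUnitEnd (mor (α_ (w * x) y z).hom) +
    _ • toUnitEnd (mor (α_ w (x * y) z).hom) +
    _ • toUnitEnd (mor (α_ w x (y * z)).hom) +
    _ • toUnitEnd (mor (α_ w x y).hom)) = _ at h
  rw [← h]
  norm_num
  abel

lemma toUnitEnd_ident (x : C.cat.Obj) : toUnitEnd (C.cat.ident x) = 0 := by
  refine Subtype.ext ?_
  rw [coe_toUnitEnd, C.cat.src_ident, tensorMor_ident, mul_inv_cancel]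
  rfl

lemma continuous_toUnitEnd : Continuous (toUnitEnd : C.cat.Mor → C.UnitEnd) :=
  (continuous_tensorMor continuous_id (C.cat.continuous_ident.comp
    (C.continuous_inv.continuous_obj.comp C.cat.continuous_src))).subtype_mk _

/-- If the group of objects is compact and connected and the endomorphisms of the unit have an
exponential, then the associator has a continuous primitive. -/
theorem exists_associator_primitive {V : Type*} [NormedAddCommGroup V] [NormedSpace ℝ V]
    [FiniteDimensional ℝ V] {p : V →+ C.UnitEnd} {s : C.UnitEnd → V} (hp : IsExponential p s)
    [CompactSpace C.cat.Obj] [PreconnectedSpace C.cat.Obj] :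
    ∃ b : C.cat.Obj × C.cat.Obj → C.UnitEnd, Continuous b ∧ ∀ x y z : C.cat.Obj,
      toUnitEnd (mor (α_ x y z).hom) =
        x • b (y, z) - b (x * y, z) + b (x, y * z) - b (x, y) :=
  hp.exists_primitive (a := fun t => toUnitEnd (mor (α_ t.1 t.2.1 t.2.2).hom))
    (continuous_toUnitEnd.comp C.continuous_associator_hom) toUnitEnd_associator_cocycle

lemma associatorClass_eq_zero_of_primitive {b : C.cat.Obj × C.cat.Obj → C.UnitEnd}
    (hb : Continuous b) (h : ∀ x y z : C.cat.Obj, toUnitEnd (mor (α_ x y z).hom) =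
      x • b (y, z) - b (x * y, z) + b (x, y * z) - b (x, y)) : C.associatorClass = 0 := by
  refine (QuotientAddGroup.eq_zero_iff _).2 (AddSubgroup.mem_addSubgroupOf.2 ?_)
  refine ⟨⟨fun g => b (g 0, g 1), by fun_prop⟩, ?_⟩
  ext1 g
  rw [contCochainD_two_apply]
  exact (h (g 0) (g 1) (g 2)).symm

/-- With the rules that follow, every composite of structure morphisms is evaluated in `UnitEnd`:
composition is addition, right whiskering is invisible, left whiskering is the action, unitors and
`eqToHom` give zero. Through `hom_ext_toUnitEnd`, coherence diagrams become equations in an abelian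
group. -/
lemma toUnitEnd_comp {x y z : C.cat.Obj} (f : x ⟶ y) (g : y ⟶ z) :
    toUnitEnd (mor (f ≫ g)) = toUnitEnd (mor f) + toUnitEnd (mor g) :=
  toUnitEnd_compMor (mor f) (mor g) (by rw [src_mor, src_mor]; exact eq_of_hom f)

lemma toUnitEnd_id (x : C.cat.Obj) : toUnitEnd (mor (𝟙 x)) = 0 := toUnitEnd_ident x

lemma toUnitEnd_whiskerRight {x y : C.cat.Obj} (f : x ⟶ y) (z : C.cat.Obj) :
    toUnitEnd (mor (f ▷ z)) = toUnitEnd (mor f) := by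
  rw [← tensorHom_id, ← tensorMor_mor, mor_id, toUnitEnd_tensor_ident]

lemma toUnitEnd_whiskerLeft {x y : C.cat.Obj} (z : C.cat.Obj) (f : x ⟶ y) :
    toUnitEnd (mor (z ◁ f)) = z • toUnitEnd (mor f) := by
  rw [← id_tensorHom, ← tensorMor_mor, mor_id, toUnitEnd_ident_tensor]

lemma toUnitEnd_leftUnitor (x : C.cat.Obj) : toUnitEnd (mor (λ_ x).hom) = 0 := by
  rw [C.leftUnitor_eq, toUnitEnd_ident]

lemma toUnitEnd_rightUnitor (x : C.cat.Obj) : toUnitEnd (mor (ρ_ x).hom) = 0 := by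
  rw [C.rightUnitor_eq, toUnitEnd_ident]

lemma toUnitEnd_eqToHom {x y : C.cat.Obj} (h : x = y) : toUnitEnd (mor (eqToHom h)) = 0 := by
  subst h
  exact toUnitEnd_ident x

/-- In a special topological 2-group, a morphism with given source and target is determined by the
corresponding endomorphism of the unit. -/
lemma hom_ext_toUnitEnd {x y : C.cat.Obj} {f g : x ⟶ y}
    (h : toUnitEnd (mor f) = toUnitEnd (mor g)) : f = g := by
  refine mor_injective (tensorMor_ident_injective _ _ x⁻¹ (by rw [src_mor, src_mor]) ?_)
  have h' := congrArg Subtype.val h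
  rwa [coe_toUnitEnd, coe_toUnitEnd, src_mor, src_mor] at h'

/-- The primitive of the associator can be chosen to be normalised. -/
lemma exists_normalised_primitive {b : C.cat.Obj × C.cat.Obj → C.UnitEnd}
    (hb : Continuous b) (h : ∀ x y z : C.cat.Obj, toUnitEnd (mor (α_ x y z).hom) =
      x • b (y, z) - b (x * y, z) + b (x, y * z) - b (x, y)) :
    ∃ b' : C.cat.Obj × C.cat.Obj → C.UnitEnd, Continuous b' ∧
      (∀ x y z : C.cat.Obj, toUnitEnd (mor (α_ x y z).hom) =
        x • b' (y, z) - b' (x * y, z) + b' (x, y * z) - b' (x, y)) ∧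
      (∀ x, b' (1, x) = 0) ∧ ∀ x, b' (x, 1) = 0 := by
  -- The unitors being identities, the triangle identity forces the associator to be trivial when
  -- its middle argument is `1`.
  have htri : ∀ x y : C.cat.Obj, toUnitEnd (mor (α_ x 1 y).hom) = 0 := by
    intro x y
    have e := congrArg (fun f => toUnitEnd (mor f)) (triangle x y)
    simp only [toUnitEnd_comp, toUnitEnd_whiskerLeft, toUnitEnd_whiskerRight,
      toUnitEnd_leftUnitor, toUnitEnd_rightUnitor, smul_zero, add_zero] at e
    exact e
  have hassoc : ∀ y : C.cat.Obj, toUnitEnd (mor (α_ 1 1 y).hom) = 0 ∧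
      toUnitEnd (mor (α_ y 1 1).hom) = 0 := fun y => ⟨htri 1 y, htri y 1⟩
  -- The subtracted cochain is the coboundary of the constant 1-cochain `b (1, 1)`, so the
  -- differential is unchanged. The equations at `(1, 1, x)` and `(x, 1, 1)` give `b (1, x) = b (1,
  -- 1)` and `b (x, 1) = x • b (1, 1)`.
  refine ⟨fun q => b q - q.1 • b (1, 1), by fun_prop, fun x y z => ?_, fun x => ?_, fun x => ?_⟩
  · rw [h]
    simp only [smul_sub, smul_smul]
    abel
  · have := h 1 1 x
    simp only [(hassoc x).1, one_smul, one_mul, sub_self, zero_add] at this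
    simp only [one_smul]
    exact this.symm
  · have := h x 1 1
    simp only [(hassoc x).2, mul_one, sub_add_cancel] at this
    exact (neg_eq_zero.1 (by rw [neg_sub]; exact this.symm))

end AssociatorPrimitive

end SpecialTopologicalTwoGroup

/-! ### Strictification: replacing the associator by the identity -/

namespace SpecialTopologicalTwoGroup

variable (C : SpecialTopologicalTwoGroup.{u})

/-- The monoidal structure obtained from that of a special topological 2-group by replacing the
associator by the identity. -/
abbrev strictMonoidal : MonoidalCategory C.cat.Obj where
  tensorObj x y := x ⊗ y
  whiskerLeft x _ _ f := x ◁ f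
  whiskerRight f y := f ▷ y
  tensorHom f g := f ⊗ₘ g
  tensorUnit := 𝟙_ C.cat.Obj
  associator x y z := eqToIso (mul_assoc x y z)
  leftUnitor x := λ_ x
  rightUnitor x := ρ_ x
  tensorHom_def f g := tensorHom_def f g
  id_tensorHom_id x y := id_tensorHom_id x y
  tensorHom_comp_tensorHom f₁ f₂ g₁ g₂ := tensorHom_comp_tensorHom f₁ f₂ g₁ g₂
  whiskerLeft_id x y := whiskerLeft_id x y
  id_whiskerRight x y := id_whiskerRight x y
  -- Identities are natural here because tensoring of morphisms is strictly associative, by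
  -- `tensorMor_assoc`.
  associator_naturality {x₁ x₂ x₃ y₁ y₂ y₃} f₁ f₂ f₃ := by
    refine hom_ext_toUnitEnd ?_
    simp only [eqToIso.hom, toUnitEnd_comp]
    refine (congrArg (_ + ·) (toUnitEnd_eqToHom _)).trans
      (Eq.trans ?_ (congrArg (· + _) (toUnitEnd_eqToHom _)).symm)
    simp only [← tensorMor_mor, tensorMor_assoc, add_zero, zero_add]
  leftUnitor_naturality f := leftUnitor_naturality f
  rightUnitor_naturality f := rightUnitor_naturality f
  pentagon w x y z := by
    refine hom_ext_toUnitEnd ?_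
    simp only [eqToIso.hom, toUnitEnd_comp]
    erw [toUnitEnd_whiskerRight, toUnitEnd_whiskerLeft, toUnitEnd_eqToHom, toUnitEnd_eqToHom,
      toUnitEnd_eqToHom, toUnitEnd_eqToHom, toUnitEnd_eqToHom]
    simp
  triangle x y := by
    refine hom_ext_toUnitEnd ?_
    simp only [eqToIso.hom, toUnitEnd_comp]
    erw [toUnitEnd_whiskerRight, toUnitEnd_whiskerLeft, toUnitEnd_eqToHom, toUnitEnd_leftUnitor,
      toUnitEnd_rightUnitor]
    simp

variable {C} in
lemma mor_eqToHom {x y : C.cat.Obj} (h : x = y) : mor (eqToHom h) = C.cat.ident x := by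
  subst h
  rfl

variable {C} in
lemma toUnitEnd_inv {x y : C.cat.Obj} (f : x ≅ y) :
    toUnitEnd (mor f.inv) = - toUnitEnd (mor f.hom) := by
  refine eq_neg_of_add_eq_zero_left ?_
  rw [← toUnitEnd_comp, f.inv_hom_id, toUnitEnd_id]

/-- The strict special topological 2-group obtained from a special one by replacing the associator
by the identity. -/
abbrev strictification : SpecialTopologicalTwoGroup.{u} where
  cat := C.cat
  monoidal := C.strictMonoidal
  inv := C.inv
  unit := C.unit
  counit := C.counit
  unit_naturality := C.unit_naturality
  counit_naturality := C.counit_naturality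
  -- Every morphism in either zig-zag now has trivial class in `UnitEnd`, so both sides are zero.
  zigzag_first x := by
    refine hom_ext_toUnitEnd ?_
    simp only [toUnitEnd_comp]
    erw [toUnitEnd_whiskerRight, toUnitEnd_whiskerLeft, toUnitEnd_eqToHom, toUnitEnd_leftUnitor,
      toUnitEnd_inv, toUnitEnd_rightUnitor, C.unit_eq, C.counit_eq, toUnitEnd_ident]
    · simp
    · exact mul_assoc x x⁻¹ x
  zigzag_second x := by
    refine hom_ext_toUnitEnd ?_
    simp only [toUnitEnd_comp]
    erw [toUnitEnd_whiskerRight, toUnitEnd_whiskerLeft, toUnitEnd_eqToHom, toUnitEnd_rightUnitor,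
      toUnitEnd_inv, toUnitEnd_leftUnitor, C.unit_eq, C.counit_eq, toUnitEnd_ident]
    · simp
    · exact (mul_assoc x⁻¹ x x⁻¹).symm
  continuous_tensorObj := C.continuous_tensorObj
  continuous_tensorHom := C.continuous_tensorHom
  continuous_inv := C.continuous_inv
  continuous_associator_hom := by
    have h : Continuous fun p : C.cat.Obj × C.cat.Obj × C.cat.Obj =>
        C.cat.ident (p.1 * p.2.1 * p.2.2) := C.cat.continuous_ident.comp (by fun_prop)
    exact h.congr fun p => (mor_eqToHom (mul_assoc p.1 p.2.1 p.2.2)).symm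
  continuous_associator_inv := by
    have h : Continuous fun p : C.cat.Obj × C.cat.Obj × C.cat.Obj =>
        C.cat.ident (p.1 * (p.2.1 * p.2.2)) := C.cat.continuous_ident.comp (by fun_prop)
    exact h.congr fun p => (mor_eqToHom (mul_assoc p.1 p.2.1 p.2.2).symm).symm
  continuous_leftUnitor_hom := C.continuous_leftUnitor_hom
  continuous_leftUnitor_inv := C.continuous_leftUnitor_inv
  continuous_rightUnitor_hom := C.continuous_rightUnitor_hom
  continuous_rightUnitor_inv := C.continuous_rightUnitor_inv
  continuous_unit_hom := C.continuous_unit_hom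
  continuous_unit_inv := C.continuous_unit_inv
  continuous_counit_hom := C.continuous_counit_hom
  continuous_counit_inv := C.continuous_counit_inv
  skeletal := C.skeletal
  leftUnitor_eq := C.leftUnitor_eq
  rightUnitor_eq := C.rightUnitor_eq
  unit_eq := C.unit_eq
  counit_eq := C.counit_eq

lemma strictification_isStrict : C.strictification.IsStrict := fun x y z =>
  mor_eqToHom (C := C) (mul_assoc x y z)

end SpecialTopologicalTwoGroup

/-! ### Equivalence with the strictification -/

namespace SpecialTopologicalTwoGroup

section Twist

variable {C : SpecialTopologicalTwoGroup.{u}}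

lemma toUnitEnd_coe (h : C.UnitEnd) : toUnitEnd h.1 = h := by
  refine Subtype.ext ?_
  have e : C.cat.src h.1 = 1 := h.2
  rw [coe_toUnitEnd, e, inv_one, tensorMor_one]

/-- The automorphism of an object corresponding to an endomorphism of the unit object. -/
def twistHom (x : C.cat.Obj) (h : C.UnitEnd) : x ⟶ x :=
  endo (tensorMor h.1 (C.cat.ident x)) (by
    rw [src_tensorMor, C.cat.src_ident, h.2]
    exact one_mul x)

lemma toUnitEnd_twistHom (x : C.cat.Obj) (h : C.UnitEnd) :
    toUnitEnd (mor (twistHom x h)) = h := by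
  rw [twistHom, mor_endo, toUnitEnd_tensor_ident, toUnitEnd_coe]

/-- The automorphism of an object corresponding to an endomorphism of the unit object, as an
isomorphism. -/
def twist (x : C.cat.Obj) (h : C.UnitEnd) : x ≅ x where
  hom := twistHom x h
  inv := twistHom x (-h)
  hom_inv_id := hom_ext_toUnitEnd (by
    rw [toUnitEnd_comp, toUnitEnd_twistHom, toUnitEnd_twistHom, toUnitEnd_id, add_neg_cancel])
  inv_hom_id := hom_ext_toUnitEnd (by
    rw [toUnitEnd_comp, toUnitEnd_twistHom, toUnitEnd_twistHom, toUnitEnd_id, neg_add_cancel])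

lemma toUnitEnd_twist_hom (x : C.cat.Obj) (h : C.UnitEnd) :
    toUnitEnd (mor (twist x h).hom) = h := toUnitEnd_twistHom x h

lemma continuous_twistHom {T : Type*} [TopologicalSpace T] {x : T → C.cat.Obj} {h : T → C.UnitEnd}
    (hx : Continuous x) (hh : Continuous h) : Continuous fun t => mor (twistHom (x t) (h t)) :=
  continuous_tensorMor (continuous_subtype_val.comp hh) (C.cat.continuous_ident.comp hx)

variable {b : C.cat.Obj × C.cat.Obj → C.UnitEnd}

/-- The identity functor from a special topological 2-group to its strictification is monoidal,
through a normalised primitive of the associator. -/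
abbrev toStrictMonoidal (h : ∀ x y z : C.cat.Obj, toUnitEnd (mor (α_ x y z).hom) =
      x • b (y, z) - b (x * y, z) + b (x, y * z) - b (x, y))
    (hl : ∀ x, b (1, x) = 0) (hr : ∀ x, b (x, 1) = 0) :
    Functor.CoreMonoidal (C := C.cat.Obj) (D := C.strictification.cat.Obj)
      (𝟭 C.cat.Obj : C.cat.Obj ⥤ C.cat.Obj) where
  εIso := Iso.refl (𝟙_ C.cat.Obj)
  μIso x y := twist (x ⊗ y) (b (x, y))
  μIso_hom_natural_left {x y} f z := by
    -- By skeletality the same value of `b` appears on both sides, and naturality becomes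
    -- commutativity of `UnitEnd`.
    obtain rfl := eq_of_hom f
    refine hom_ext_toUnitEnd ?_
    simp only [Functor.id_obj, Functor.id_map, toUnitEnd_comp]
    exact add_comm _ _
  μIso_hom_natural_right {x y} z f := by
    obtain rfl := eq_of_hom f
    refine hom_ext_toUnitEnd ?_
    simp only [Functor.id_obj, Functor.id_map, toUnitEnd_comp]
    exact add_comm _ _
  -- The associator is trivial in the target, so coherence of the monoidal functor is precisely the
  -- equation `a = db`.
  associativity x y z := by
    refine hom_ext_toUnitEnd ?_
    simp only [Functor.id_obj, Functor.id_map, toUnitEnd_comp]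
    erw [toUnitEnd_whiskerRight, toUnitEnd_whiskerLeft]
    erw [toUnitEnd_twist_hom, toUnitEnd_twist_hom, toUnitEnd_twist_hom, toUnitEnd_twist_hom,
      toUnitEnd_eqToHom, h]
    · change b (x, y) + (b (x * y, z) + (x • b (y, z) - b (x * y, z) + b (x, y * z) - b (x, y))) =
        0 + (x • b (y, z) + b (x, y * z))
      abel
    · exact mul_assoc x y z
  -- With the unit constraint an identity, the two unit laws amount to `b (1, x) = 0` and `b (x, 1)
  -- = 0`; this is why `b` has to be normalised.
  left_unitality x := by
    refine hom_ext_toUnitEnd ?_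
    simp only [Functor.id_obj, Functor.id_map, toUnitEnd_comp]
    erw [toUnitEnd_whiskerRight, toUnitEnd_leftUnitor, toUnitEnd_id]
    erw [toUnitEnd_twist_hom, hl]
    simp
  right_unitality x := by
    refine hom_ext_toUnitEnd ?_
    simp only [Functor.id_obj, Functor.id_map, toUnitEnd_comp]
    erw [toUnitEnd_whiskerLeft, toUnitEnd_rightUnitor, toUnitEnd_id]
    erw [toUnitEnd_twist_hom, hr]
    change (0 : C.UnitEnd) = x • 0 + (0 + 0)
    simp

/-- The identity functor from the strictification of a special topological 2-group is monoidal,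
through the negative of a normalised primitive of the associator. -/
abbrev ofStrictMonoidal (h : ∀ x y z : C.cat.Obj, toUnitEnd (mor (α_ x y z).hom) =
      x • b (y, z) - b (x * y, z) + b (x, y * z) - b (x, y))
    (hl : ∀ x, b (1, x) = 0) (hr : ∀ x, b (x, 1) = 0) :
    Functor.CoreMonoidal (C := C.strictification.cat.Obj) (D := C.cat.Obj)
      (𝟭 C.cat.Obj : C.cat.Obj ⥤ C.cat.Obj) where
  εIso := Iso.refl (𝟙_ C.cat.Obj)
  μIso x y := twist (C := C) (x ⊗ y) (-b (x, y))
  μIso_hom_natural_left {x y} f z := by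
    obtain rfl := eq_of_hom (C := C) f
    refine hom_ext_toUnitEnd ?_
    simp only [Functor.id_obj, Functor.id_map, toUnitEnd_comp, toUnitEnd_twist_hom]
    exact add_comm _ _
  μIso_hom_natural_right {x y} z f := by
    obtain rfl := eq_of_hom (C := C) f
    refine hom_ext_toUnitEnd ?_
    simp only [Functor.id_obj, Functor.id_map, toUnitEnd_comp, toUnitEnd_twist_hom]
    exact add_comm _ _
  associativity x y z := by
    refine hom_ext_toUnitEnd ?_
    simp only [Functor.id_obj, Functor.id_map, toUnitEnd_comp]
    erw [toUnitEnd_whiskerRight, toUnitEnd_whiskerLeft]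
    simp only [toUnitEnd_twist_hom]
    erw [toUnitEnd_eqToHom, h]
    · have key : ∀ x y z : C.cat.Obj, -b (x, y) + (-b (x * y, z) + 0) =
          x • b (y, z) - b (x * y, z) + b (x, y * z) - b (x, y) +
            (x • -b (y, z) + -b (x, y * z)) := by
        intro x y z
        rw [smul_neg]
        abel
      exact key x y z
    · exact mul_assoc (G := C.cat.Obj) x y z
  left_unitality x := by
    refine hom_ext_toUnitEnd ?_
    simp only [Functor.id_obj, Functor.id_map, toUnitEnd_comp]
    erw [toUnitEnd_whiskerRight, toUnitEnd_leftUnitor, toUnitEnd_id]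
    simp only [toUnitEnd_twist_hom]
    erw [hl]
    simp
  right_unitality x := by
    refine hom_ext_toUnitEnd ?_
    simp only [Functor.id_obj, Functor.id_map, toUnitEnd_comp]
    erw [toUnitEnd_whiskerLeft, toUnitEnd_rightUnitor, toUnitEnd_id]
    simp only [toUnitEnd_twist_hom]
    erw [hr]
    simp

end Twist

variable {C : SpecialTopologicalTwoGroup.{u}}

/-- An endomorphism of a special topological 2-group whose underlying functor is the identity and
whose structure morphisms are identities is isomorphic to the identity. -/
lemma nonempty_twoIso_id (K : C.toTopologicalTwoGroup.Hom C.toTopologicalTwoGroup)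
    (i : K.functor ≅ 𝟭 C.cat.Obj) (hi : ∀ x, toUnitEnd (mor (i.hom.app x)) = 0)
    (hε : toUnitEnd (mor (Functor.LaxMonoidal.ε K.functor)) = 0)
    (hμ : ∀ x y, toUnitEnd (mor (Functor.LaxMonoidal.μ K.functor x y)) = 0) :
    Nonempty (TopologicalTwoGroup.TwoIso K (.id C.toTopologicalTwoGroup)) := by
  have hi' : ∀ x, toUnitEnd (mor (i.inv.app x)) = 0 := fun x => by
    have := toUnitEnd_comp (i.hom.app x) (i.inv.app x)
    rw [i.hom_inv_id_app, toUnitEnd_id, hi, zero_add] at this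
    exact this.symm
  -- A morphism of trivial class is an identity, so the components of both transformations depend
  -- continuously on the object.
  have hm : ∀ {x y : C.cat.Obj} (f : x ⟶ y), toUnitEnd (mor f) = 0 → mor f = C.cat.ident x := by
    intro x y f hf
    have hxy := eq_of_hom f
    subst hxy
    have : f = 𝟙 x := hom_ext_toUnitEnd (hf.trans (toUnitEnd_id x).symm)
    rw [this, mor_id]
  have ht : ∀ {x y x' y' : C.cat.Obj} (f : x ⟶ y) (g : x' ⟶ y'), toUnitEnd (mor f) = 0 →
      toUnitEnd (mor g) = 0 → toUnitEnd (mor (f ⊗ₘ g)) = 0 := by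
    intro x y x' y' f g hf hg
    rw [MonoidalCategory.tensorHom_def, toUnitEnd_comp, toUnitEnd_whiskerLeft,
      toUnitEnd_whiskerRight, hf, hg, smul_zero, add_zero]
  have hmon : NatTrans.IsMonoidal i.hom :=
    { unit := hom_ext_toUnitEnd (by
        rw [toUnitEnd_comp, hi, hε, add_zero]
        exact (toUnitEnd_id _).symm)
      tensor := fun x y => hom_ext_toUnitEnd (by
        rw [toUnitEnd_comp, toUnitEnd_comp, hi, hμ, ht _ _ (hi x) (hi y)]
        exact congrArg (0 + ·) (toUnitEnd_id _).symm) }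
  have hmon' : @NatTrans.IsMonoidal _ _ _ _ _ _ (𝟭 C.cat.Obj) K.functor i.inv
      (TopologicalTwoGroup.Hom.id C.toTopologicalTwoGroup).monoidal.toLaxMonoidal _ :=
    { unit := hom_ext_toUnitEnd (by
        rw [toUnitEnd_comp, hi', hε, add_zero]
        exact toUnitEnd_id _)
      tensor := fun x y => hom_ext_toUnitEnd (by
        rw [toUnitEnd_comp, toUnitEnd_comp, hi', hμ, ht _ _ (hi' x) (hi' y)]
        exact congrArg (· + 0) (toUnitEnd_id _)) }
  exact ⟨{
    hom :=
      { nat := i.hom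
        isMonoidal := hmon
        continuous_app := (C.cat.continuous_ident.comp
          K.continuous_functor.continuous_obj).congr fun x => (hm _ (hi x)).symm }
    inv :=
      { nat := i.inv
        isMonoidal := hmon'
        continuous_app := C.cat.continuous_ident.congr fun x => (hm _ (hi' x)).symm }
    hom_inv_id := i.hom_inv_id
    inv_hom_id := i.inv_hom_id }⟩

/-- A special topological 2-group whose associator has a continuous normalised primitive is
equivalent to its strictification. -/
theorem equivalent_strictification {b : C.cat.Obj × C.cat.Obj → C.UnitEnd} (hb : Continuous b)
    (h : ∀ x y z : C.cat.Obj, toUnitEnd (mor (α_ x y z).hom) =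
      x • b (y, z) - b (x * y, z) + b (x, y * z) - b (x, y))
    (hl : ∀ x, b (1, x) = 0) (hr : ∀ x, b (x, 1) = 0) : C.Equivalent C.strictification := by
  let F : C.toTopologicalTwoGroup.Hom C.strictification.toTopologicalTwoGroup :=
    { functor := (𝟭 C.cat.Obj : C.cat.Obj ⥤ C.cat.Obj)
      monoidal := (toStrictMonoidal h hl hr).toMonoidal
      continuous_functor := .id
      continuous_μ := continuous_twistHom C.continuous_tensorObj hb
      continuous_δ := continuous_twistHom C.continuous_tensorObj hb.neg }
  let G : C.strictification.toTopologicalTwoGroup.Hom C.toTopologicalTwoGroup :=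
    { functor := (𝟭 C.cat.Obj : C.cat.Obj ⥤ C.cat.Obj)
      monoidal := (ofStrictMonoidal h hl hr).toMonoidal
      continuous_functor := .id
      continuous_μ := continuous_twistHom (C := C) C.continuous_tensorObj hb.neg
      continuous_δ := continuous_twistHom (C := C) C.continuous_tensorObj hb.neg.neg }
  -- In either composite the multiplication constraints `b` and `-b` cancel, leaving the identity
  -- functor with trivial constraints.
  refine ⟨F, G, rfl, rfl, ?_, ?_⟩
  · refine nonempty_twoIso_id (F.comp G) (Iso.refl (𝟭 C.cat.Obj)) (fun x => toUnitEnd_id x) ?_ ?_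
    · change toUnitEnd (mor (𝟙 (𝟙_ C.cat.Obj) ≫ 𝟙 (𝟙_ C.cat.Obj))) = 0
      rw [toUnitEnd_comp, toUnitEnd_id, add_zero]
    · intro x y
      change toUnitEnd (mor (twistHom (x ⊗ y) (-b (x, y)) ≫ twistHom (x ⊗ y) (b (x, y)))) = 0
      rw [toUnitEnd_comp, toUnitEnd_twistHom, toUnitEnd_twistHom, neg_add_cancel]
  · refine nonempty_twoIso_id (C := C.strictification) (G.comp F) (Iso.refl (𝟭 C.cat.Obj))
      (fun x => toUnitEnd_id (C := C) x) ?_ ?_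
    · change toUnitEnd (C := C) (mor (𝟙 (𝟙_ C.cat.Obj) ≫ 𝟙 (𝟙_ C.cat.Obj))) = 0
      rw [toUnitEnd_comp, toUnitEnd_id, add_zero]
    · intro x y
      change toUnitEnd (C := C) (mor (twistHom (C := C) (x * y) (b (x, y)) ≫
        twistHom (C := C) (x * y) (-b (x, y)))) = 0
      rw [toUnitEnd_comp, toUnitEnd_twistHom, toUnitEnd_twistHom, add_neg_cancel]

end SpecialTopologicalTwoGroup

/-! ### Transport along isomorphisms, and the main theorem -/

/-- Exponentials may be transported along isomorphisms of topological groups. -/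
lemma IsExponential.congr {V A B : Type*} [TopologicalSpace V] [AddCommGroup V]
    [TopologicalSpace A] [AddCommGroup A] [TopologicalSpace B] [AddCommGroup B] {p : V →+ A}
    {s : A → V} (hp : IsExponential p s) (e : A ≃ₜ+ B) :
    IsExponential ((e : A →+ B).comp p) (s ∘ e.symm) := by
  have t : Filter.Tendsto e.symm (nhds 0) (nhds 0) := by
    have h : Filter.Tendsto e.symm (nhds 0) (nhds (e.symm 0)) := e.symm.continuous.tendsto 0
    rwa [map_zero] at h
  refine ⟨e.continuous.comp hp.continuous, ?_, ?_, ?_, ?_⟩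
  · filter_upwards [t.eventually hp.continuousAt_section] with x hx
    exact ContinuousAt.comp hx e.symm.continuous.continuousAt
  · filter_upwards [t.eventually hp.right_inv] with x hx
    simp [hx]
  · filter_upwards [hp.left_inv] with v hv
    simp [hv]
  · simp [hp.section_zero]

theorem mainTheorem9
    {EG MG EH MH : Type*}
    [NormedAddCommGroup EG] [NormedSpace ℝ EG] [FiniteDimensional ℝ EG] [TopologicalSpace MG]
    (IG : ModelWithCorners ℝ EG MG) [IG.Boundaryless]
    [NormedAddCommGroup EH] [NormedSpace ℝ EH] [FiniteDimensional ℝ EH] [TopologicalSpace MH]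
    (IH : ModelWithCorners ℝ EH MH) [IH.Boundaryless]
    -- a connected compact Lie group `G`
    (G : Type*) [Group G] [TopologicalSpace G] [ChartedSpace MG G]
    [LieGroup IG (⊤ : ℕ∞) G] [T2Space G] [CompactSpace G] [ConnectedSpace G]
    -- a connected abelian Lie group `H`, written additively
    (H : Type*) [AddCommGroup H] [TopologicalSpace H] [ChartedSpace MH H]
    [LieAddGroup IH (⊤ : ℕ∞) H] [T2Space H] [ConnectedSpace H]
    -- a special topological 2-group with `G` as its group of objects and `H` as the group of
    -- endomorphisms of its unit object
    (C : SpecialTopologicalTwoGroup.{u}) (eG : G ≃ₜ* C.cat.Obj) (eH : H ≃ₜ+ C.UnitEnd) :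
    C.associatorClass = 0 ∧
      ∃ D : SpecialTopologicalTwoGroup.{u}, D.IsStrict ∧ C.Equivalent D := by
  obtain ⟨p, s, hp⟩ := exists_isExponential_lieAddGroup IH H
  have hp' := hp.congr eH
  have : CompactSpace C.cat.Obj := eG.toHomeomorph.compactSpace
  have : PreconnectedSpace C.cat.Obj := eG.surjective.denseRange.preconnectedSpace eG.continuous
  obtain ⟨b, hb, h⟩ := SpecialTopologicalTwoGroup.exists_associator_primitive hp'
  -- Any primitive kills the class; the equivalence through special homomorphisms uses the
  -- normalised one.
  obtain ⟨b', hb', h', hl, hr⟩ := SpecialTopologicalTwoGroup.exists_normalised_primitive hb h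
  exact ⟨SpecialTopologicalTwoGroup.associatorClass_eq_zero_of_primitive hb h, C.strictification,
    C.strictification_isStrict, SpecialTopologicalTwoGroup.equivalent_strictification hb' h' hl hr⟩
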